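/- Let $n\ge 1$. A cube is a set $\prod_{i=1}^n[a_i,a_i+\ell)\subset\mathbb R^n$ with $\ell>0$. Let $p_1,p_2:\mathbb R^n\to[1,\infty]$ be measurable, let $p$ be defined by $\frac1{p(x)}=\frac1{p_1(x)}+\frac1{p_2(x)}$ and $p_j'$ by $\frac1{p_j(x)}+\frac1{p_j'(x)}=1$ (with $\frac1\infty=0$). For measurable $q:\mathbb R^n\to(0,\infty]$ and measurable $f$ put $$\rho_q(f)=\int_{\{q<\infty\}}|f(x)|^{q(x)}\,dx+\|f\|_{L^\infty(\{q=\infty\})},\qquad \|f\|_{q(\cdot)}=\inf\{\lambda>0:\rho_q(f/\lambda)\le 1\}.$$ Let $w_1,w_2$ be weights, i.e. measurable functions with values in $[0,\infty]$ and $0<w_j<\infty$ a.e., and let $w=w_1w_2$. The space $L^{q(\cdot)}(v)$ consists of the measurable $f:\mathbb R^n\to\mathbb C$ with $\rho_q(fv/\lambda)<\infty$ for some $\lambda>0$. Write $(w_1,w_2,w)\in\mathcal A_{\vec p(\cdot)}$ if $$\sup_Q |Q|^{-2}\,\|w\chi_Q\|_{p(\cdot)}\,\|w_1^{-1}\chi_Q\|_{p_1'(\cdot)}\,\|w_2^{-1}\chi_Q\|_{p_2'(\cdot)}<\infty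 ,$$ the supremum being over all cubes. For a cube $Q$ let $A_Q(f_1,f_2)=\langle f_1\rangle_Q\langle f_2\rangle_Q\,\chi_Q$, where $\langle f\rangle_Q=\frac1{|Q|}\int_Q f\,dx$, and for a family $\mathcal Q$ of pairwise disjoint cubes let $T_{\mathcal Q}(f_1,f_2)=\sum_{Q\in\mathcal Q}A_Q(f_1,f_2)\chi_Q$. (1) $(w_1,w_2,w)\in\mathcal A_{\vec p(\cdot)}$ if and only if there is a constant $C<\infty$ such that for all $f_1\in L^{p_1(\cdot)}(w_1)$, $f_2\in L^{p_2(\cdot)}(w_2)$ and all cubes $Q$, the functions $f_1,f_2$ are integrable on $Q$ and $$\|A_Q(f_1,f_2)w\|_{p(\cdot)}\le C\,\|f_1w_1\|_{p_1(\cdot)}\|f_2w_2\|_{p_2(\cdot)} .$$ (2) Suppose in addition that $q=p_1$ and $q=p_2$ are log-Hölder continuous, i.e. there are $C_0$, $C_\infty>0$ and $q_\infty\in(0,\infty]$ with $\left|\frac1{q(x)}-\frac1{q(y)}\right|\le\frac{C_0}{-\log|x-y|}$ whenever $|x-y|<\frac12$ (both sides being read as $0$ if $x=y$), and $\left|\frac1{q(x)}-\frac1{q_\infty}\right|\le\frac{C_\infty}{\log(e+|x|)}$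 for all $x$. Then $(w_1,w_2,w)\in\mathcal A_{\vec p(\cdot)}$ if and only if there is a constant $C<\infty$ such that for all $f_1\in L^{p_1(\cdot)}(w_1)$, $f_2\in L^{p_2(\cdot)}(w_2)$ and all families $\mathcal Q$ of pairwise disjoint cubes, $f_1,f_2$ are integrable on every $Q\in\mathcal Q$ and $$\|T_{\mathcal Q}(f_1,f_2)w\|_{p(\cdot)}\le C\,\|f_1w_1\|_{p_1(\cdot)}\|f_2w_2\|_{p_2(\cdot)} .$$ -/

import Mathlib

open MeasureTheory
open scoped ENNReal NNReal

noncomputable section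

namespace VarLp

/-- Euclidean space `ℝⁿ`. -/
abbrev Rn (n : ℕ) : Type := EuclideanSpace ℝ (Fin n)

/-- A cube in `ℝⁿ` with sides parallel to the axes: `∏ᵢ [aᵢ, aᵢ + ℓ)` with `ℓ > 0`.
With half-open cubes, pairwise disjointness means the same as having pairwise disjoint interiors,
so families of disjoint cubes include all tilings. -/
def IsCube {n : ℕ} (Q : Set (Rn n)) : Prop :=
  ∃ (a : Rn n) (l : ℝ), 0 < l ∧ Q = {x | ∀ i, a i ≤ x i ∧ x i < a i + l}

/-- Exponent functions: (Lebesgue) measurable `p : ℝⁿ → [1, ∞]`. -/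
structure IsExponent {n : ℕ} (p : Rn n → ℝ≥0∞) : Prop where
  aemeasurable : AEMeasurable p volume
  one_le : ∀ x, 1 ≤ p x

/-- The dual exponent, `1 / p + 1 / p' = 1`, with `1 / ∞ = 0` (so `1' = ∞` and `∞' = 1`). -/
def dualExp {n : ℕ} (p : Rn n → ℝ≥0∞) : Rn n → ℝ≥0∞ :=
  fun x => (1 - (p x)⁻¹)⁻¹

/-- The exponent `p` given by `1 / p = 1 / p₁ + 1 / p₂`, with `1 / ∞ = 0`. -/
def sumExp {n : ℕ} (p₁ p₂ : Rn n → ℝ≥0∞) : Rn n → ℝ≥0∞ :=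
  fun x => ((p₁ x)⁻¹ + (p₂ x)⁻¹)⁻¹

/-- The modular `∫_{p < ∞} g ^ p + ‖g‖_{L^∞({p = ∞})}` of a function `g ≥ 0`. For a complex
function `f` it is applied to `g = |f|`. -/
def modular {n : ℕ} (p : Rn n → ℝ≥0∞) (g : Rn n → ℝ≥0∞) : ℝ≥0∞ :=
  (∫⁻ x in {x | p x ≠ ∞}, g x ^ (p x).toReal)
    + essSup g (volume.restrict {x | p x = ∞})

/-- The Luxemburg (quasi-)norm `inf {l > 0 : modular (g / l) ≤ 1}`; it is `∞` if there is no
such `l`. -/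
def luxNorm {n : ℕ} (p : Rn n → ℝ≥0∞) (g : Rn n → ℝ≥0∞) : ℝ≥0∞ :=
  ⨅ (l : ℝ≥0) (_ : 0 < l ∧ modular p (fun x => g x / (l : ℝ≥0∞)) ≤ 1), (l : ℝ≥0∞)

/-- A weight: a measurable function with values in `[0, ∞]` and `0 < w < ∞` almost everywhere. -/
structure IsWeight {n : ℕ} (w : Rn n → ℝ≥0∞) : Prop where
  aemeasurable : AEMeasurable w volume
  pos : ∀ᵐ x, 0 < w x
  lt_top : ∀ᵐ x, w x < ∞

/-- The quantity `‖f w‖_{p(·)}` for a complex function `f` and a weight `w`. -/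
def weightedNorm {n : ℕ} (p w : Rn n → ℝ≥0∞) (f : Rn n → ℂ) : ℝ≥0∞ :=
  luxNorm p (fun x => ‖f x‖ₑ * w x)

/-- `f ∈ L^{p(·)}(w)`: `f` is (Lebesgue) measurable and `f w / l` has finite modular for
some `l > 0`. -/
def MemWeighted {n : ℕ} (p w : Rn n → ℝ≥0∞) (f : Rn n → ℂ) : Prop :=
  AEStronglyMeasurable f volume ∧
    ∃ l : ℝ≥0, 0 < l ∧ modular p (fun x => ‖f x‖ₑ * w x / (l : ℝ≥0∞)) < ∞

/-- The bilinear condition `(w₁, w₂, w₁ w₂) ∈ A_{(p₁(·), p₂(·), p(·))}`. -/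
def BilinearAp {n : ℕ} (p₁ p₂ w₁ w₂ : Rn n → ℝ≥0∞) : Prop :=
  (⨆ (Q : Set (Rn n)) (_ : IsCube Q),
    ((volume Q) ^ 2)⁻¹
      * luxNorm (sumExp p₁ p₂) (Q.indicator fun x => w₁ x * w₂ x)
      * luxNorm (dualExp p₁) (Q.indicator fun x => (w₁ x)⁻¹)
      * luxNorm (dualExp p₂) (Q.indicator fun x => (w₂ x)⁻¹)) < ∞

/-- The bilinear averaging operator `A_Q(f₁, f₂) = ⟨f₁⟩_Q ⟨f₂⟩_Q χ_Q`. -/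
def avgOp {n : ℕ} (Q : Set (Rn n)) (f₁ f₂ : Rn n → ℂ) : Rn n → ℂ :=
  Q.indicator fun _ => (⨍ y in Q, f₁ y) * (⨍ y in Q, f₂ y)

/-- The operator `T_𝒬(f₁, f₂) = ∑_{Q ∈ 𝒬} A_Q(f₁, f₂) χ_Q`. When the cubes in `𝒬` are disjoint,
at each point at most one term of the sum is nonzero. -/
def famOp {n : ℕ} (𝒬 : Set (Set (Rn n))) (f₁ f₂ : Rn n → ℂ) : Rn n → ℂ :=
  fun x => ∑' Q : 𝒬, (Q : Set (Rn n)).indicator (avgOp (Q : Set (Rn n)) f₁ f₂) x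

/-- The operators `A_Q` are uniformly bounded from `L^{p₁(·)}(w₁) × L^{p₂(·)}(w₂)` to
`L^{p(·)}(w₁ w₂)`: the averages exist for all functions in these spaces, and the bound holds with
one constant for all cubes. -/
def AvgBounded {n : ℕ} (p₁ p₂ w₁ w₂ : Rn n → ℝ≥0∞) : Prop :=
  ∃ C : ℝ≥0, ∀ f₁ f₂ : Rn n → ℂ, MemWeighted p₁ w₁ f₁ → MemWeighted p₂ w₂ f₂ →
    ∀ Q : Set (Rn n), IsCube Q →
      IntegrableOn f₁ Q ∧ IntegrableOn f₂ Q ∧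
        weightedNorm (sumExp p₁ p₂) (fun x => w₁ x * w₂ x) (avgOp Q f₁ f₂)
          ≤ C * weightedNorm p₁ w₁ f₁ * weightedNorm p₂ w₂ f₂

/-- The operators `T_𝒬` are bounded from `L^{p₁(·)}(w₁) × L^{p₂(·)}(w₂)` to `L^{p(·)}(w₁ w₂)`
uniformly over all families `𝒬` of pairwise disjoint cubes. -/
def FamBounded {n : ℕ} (p₁ p₂ w₁ w₂ : Rn n → ℝ≥0∞) : Prop :=
  ∃ C : ℝ≥0, ∀ f₁ f₂ : Rn n → ℂ, MemWeighted p₁ w₁ f₁ → MemWeighted p₂ w₂ f₂ →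
    ∀ 𝒬 : Set (Set (Rn n)), (∀ Q ∈ 𝒬, IsCube Q) → 𝒬.PairwiseDisjoint id →
      (∀ Q ∈ 𝒬, IntegrableOn f₁ Q ∧ IntegrableOn f₂ Q) ∧
        weightedNorm (sumExp p₁ p₂) (fun x => w₁ x * w₂ x) (famOp 𝒬 f₁ f₂)
          ≤ C * weightedNorm p₁ w₁ f₁ * weightedNorm p₂ w₂ f₂

/-- Local log-Hölder continuity. For `x = y` both sides of the inequality are `0`. -/
def LocLogHolder {n : ℕ} (p : Rn n → ℝ≥0∞) : Prop :=
  ∃ C₀ : ℝ, ∀ x y : Rn n, ‖x - y‖ < 1 / 2 →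
    |((p x)⁻¹).toReal - ((p y)⁻¹).toReal| ≤ C₀ / (-Real.log ‖x - y‖)

/-- Log-Hölder continuity at infinity, with a limiting exponent `p_∞ ∈ (0, ∞]`. -/
def LogHolderAtInfty {n : ℕ} (p : Rn n → ℝ≥0∞) : Prop :=
  ∃ (C : ℝ) (pinf : ℝ≥0∞), 0 < C ∧ 0 < pinf ∧ ∀ x : Rn n,
    |((p x)⁻¹).toReal - (pinf⁻¹).toReal| ≤ C / Real.log (Real.exp 1 + ‖x‖)

/-- Log-Hölder continuity: locally and at infinity. -/
def LogHolder {n : ℕ} (p : Rn n → ℝ≥0∞) : Prop :=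
  LocLogHolder p ∧ LogHolderAtInfty p

end VarLp

end

open MeasureTheory
open scoped ENNReal NNReal

noncomputable section

/-! Single averages. Hölder's inequality on Q bounds ∫_Q |f_j| by 2 ‖f_j w_j‖ ‖w_j⁻¹ χ_Q‖ (dual
norm), and the Muckenhoupt constant absorbs the two dual norms together with ‖w χ_Q‖. Conversely, a
dual norm is recovered, up to a factor 3, by pairing with functions h_j of modular at most 1
(`exists_le_lintegral_mul`); testing the averages on f_j = h_j / w_j gives back the condition.

Families of cubes. No maximal function is used. Normalize u_j = |f_j| w_j / l_j to have modular at
most 1, and give each cube the energy t_j(Q) = ∫_Q u_j^{p_j} (over p_j < ∞) + ∫_Q (1+|z|)^{-n-1}.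
Energies are additive, so their sum over disjoint cubes is bounded. The second term keeps t_j(Q)
from being too small for the size and position of Q, and log-Hölder continuity then makes
t_j(Q)^{1/p_j(x)} constant in x ∈ Q up to a factor (`LogHolder.rpow_le_mul_rpow`). Hence ‖u_j χ_Q‖ ≲
t_j(Q)^{1/p_j(x)} for every x ∈ Q (`luxNorm_indicator_le_cubeEnergy`).

With τ = t_1 + t_2, Hölder, the weight condition and 1/p = 1/p_1 + 1/p_2 give |T(f_1,f_2)| w ≲ l_1
l_2 τ(Q)^{1/p(x)} w(x) / ‖w χ_Q‖ on Q. Raised to the power p(x) and integrated over Q, the right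
side without l_1 l_2 contributes a multiple of τ(Q), which is summable
(`modular_le_of_forall_cube`). For the converse, one-cube families suffice. -/

namespace VarLp

/-! ### Modulars and Luxemburg quasi-norms -/

/-- Measurable exponents bounded below by `1 / 2`. This covers `p₁`, `p₂`, their duals, and
`sumExp p₁ p₂`. -/
structure IsQuasiExponent {n : ℕ} (p : Rn n → ℝ≥0∞) : Prop where
  aemeasurable : AEMeasurable p volume
  half_le : ∀ x, 2⁻¹ ≤ p x

theorem IsExponent.isQuasiExponent {n : ℕ} {p : Rn n → ℝ≥0∞} (hp : IsExponent p) :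
    IsQuasiExponent p :=
  ⟨hp.aemeasurable, fun x => le_trans (by simp) (hp.one_le x)⟩

theorem IsExponent.inv_add_inv_dualExp {n : ℕ} {p : Rn n → ℝ≥0∞} (hp : IsExponent p) (x : Rn n) :
    (p x)⁻¹ + (dualExp p x)⁻¹ = 1 := by
  have : (p x)⁻¹ ≤ 1 := ENNReal.inv_le_one.2 (hp.one_le x)
  rw [dualExp, inv_inv, add_tsub_cancel_of_le this]

theorem IsExponent.dualExp_isExponent {n : ℕ} {p : Rn n → ℝ≥0∞} (hp : IsExponent p) :
    IsExponent (dualExp p) :=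
  ⟨(aemeasurable_const.sub hp.aemeasurable.inv).inv,
    fun _ => ENNReal.one_le_inv.2 tsub_le_self⟩

theorem IsExponent.sumExp_isQuasiExponent {n : ℕ} {p q : Rn n → ℝ≥0∞} (hp : IsExponent p)
    (hq : IsExponent q) : IsQuasiExponent (sumExp p q) := by
  refine ⟨(hp.aemeasurable.inv.add hq.aemeasurable.inv).inv, fun x => ENNReal.inv_le_inv.2 ?_⟩
  calc (p x)⁻¹ + (q x)⁻¹ ≤ 1 + 1 :=
        add_le_add (ENNReal.inv_le_one.2 (hp.one_le x)) (ENNReal.inv_le_one.2 (hq.one_le x))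
    _ = 2 := one_add_one_eq_two

theorem nullMeasurableSet_ne_top {n : ℕ} {p : Rn n → ℝ≥0∞} (hp : AEMeasurable p volume) :
    NullMeasurableSet {x | p x ≠ ∞} volume :=
  hp.nullMeasurableSet_preimage (measurableSet_singleton ∞).compl

theorem nullMeasurableSet_eq_top {n : ℕ} {p : Rn n → ℝ≥0∞} (hp : AEMeasurable p volume) :
    NullMeasurableSet {x | p x = ∞} volume :=
  hp.nullMeasurableSet_preimage (measurableSet_singleton ∞)

theorem IsQuasiExponent.half_le_toReal {n : ℕ} {p : Rn n → ℝ≥0∞} (hp : IsQuasiExponent p)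
    {x : Rn n} (hx : p x ≠ ∞) : 1 / 2 ≤ (p x).toReal := by
  have := ENNReal.toReal_mono hx (hp.half_le x)
  simpa using this

theorem modular_mono_ae {n : ℕ} {p g h : Rn n → ℝ≥0∞} (hgh : ∀ᵐ x, g x ≤ h x) :
    modular p g ≤ modular p h := by
  refine add_le_add (lintegral_mono_ae ?_) (essSup_mono_ae (ae_restrict_of_ae hgh))
  filter_upwards [ae_restrict_of_ae hgh] with x hx
  exact ENNReal.rpow_le_rpow hx ENNReal.toReal_nonneg

theorem modular_mono {n : ℕ} {p g h : Rn n → ℝ≥0∞} (hgh : ∀ x, g x ≤ h x) :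
    modular p g ≤ modular p h :=
  modular_mono_ae (Filter.Eventually.of_forall hgh)

/-- For c ≤ 1 and p ≥ 1/2 one has c^p ≤ c^{1/2}. This replaces convexity of the modular, which fails
where p < 1. -/
theorem modular_const_mul_le {n : ℕ} {p : Rn n → ℝ≥0∞} (hp : IsQuasiExponent p) {c : ℝ≥0∞}
    (hc : c ≤ 1) (g : Rn n → ℝ≥0∞) :
    modular p (fun x => c * g x) ≤ c ^ (1 / 2 : ℝ) * modular p g := by
  have hc1 : c ^ (1 / 2 : ℝ) ≠ ∞ :=
    ENNReal.rpow_ne_top_of_nonneg (by norm_num) (ne_top_of_le_ne_top ENNReal.one_ne_top hc)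
  rw [modular, modular, mul_add]
  refine add_le_add ?_ ?_
  · rw [← lintegral_const_mul' _ _ hc1]
    refine lintegral_mono_ae ?_
    filter_upwards [ae_restrict_mem₀ (nullMeasurableSet_ne_top hp.aemeasurable)] with x hx
    rw [ENNReal.mul_rpow_of_nonneg _ _ ENNReal.toReal_nonneg]
    gcongr ?_ * _
    exact ENNReal.rpow_le_rpow_of_exponent_ge hc (hp.half_le_toReal hx)
  · rw [ENNReal.essSup_const_mul]
    gcongr ?_ * _
    calc c = c ^ (1 : ℝ) := (ENNReal.rpow_one c).symm
      _ ≤ c ^ (1 / 2 : ℝ) := ENNReal.rpow_le_rpow_of_exponent_ge hc (by norm_num)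

theorem modular_zero {n : ℕ} {p : Rn n → ℝ≥0∞} (hp : IsQuasiExponent p) :
    modular p (fun _ => 0) = 0 := by
  have := modular_const_mul_le hp (zero_le (a := (1 : ℝ≥0∞))) (fun _ => 0)
  simpa using this

theorem luxNorm_le {n : ℕ} {p g : Rn n → ℝ≥0∞} {l : ℝ≥0} (hl : 0 < l)
    (h : modular p (fun x => g x / (l : ℝ≥0∞)) ≤ 1) : luxNorm p g ≤ l :=
  iInf₂_le l ⟨hl, h⟩

theorem modular_div_le_one_of_luxNorm_lt {n : ℕ} {p g : Rn n → ℝ≥0∞} {l : ℝ≥0}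
    (h : luxNorm p g < l) : modular p (fun x => g x / (l : ℝ≥0∞)) ≤ 1 := by
  simp only [luxNorm, iInf_lt_iff] at h
  obtain ⟨k, ⟨-, hk⟩, hkl⟩ := h
  exact (modular_mono fun x => ENNReal.div_le_div_left hkl.le _).trans hk

theorem luxNorm_mono_ae {n : ℕ} {p g h : Rn n → ℝ≥0∞} (hgh : ∀ᵐ x, g x ≤ h x) :
    luxNorm p g ≤ luxNorm p h := by
  refine le_iInf₂ fun l hl => luxNorm_le hl.1 ((modular_mono_ae ?_).trans hl.2)
  filter_upwards [hgh] with x hx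
  exact ENNReal.div_le_div_right hx _

theorem luxNorm_lt_top {n : ℕ} {p g : Rn n → ℝ≥0∞} (hp : IsQuasiExponent p) {l : ℝ≥0}
    (hl : 0 < l) (h : modular p (fun x => g x / (l : ℝ≥0∞)) < ∞) : luxNorm p g < ∞ := by
  lift modular p (fun x => g x / (l : ℝ≥0∞)) to ℝ≥0 using h.ne with m hm
  -- Scaling by 1/c gains only c^{-1/2} = 1/(1+m), hence the square; the new modular is at most
  -- m/(1+m).
  set c : ℝ≥0 := (1 + m) ^ 2 with hc
  have hc1 : 1 ≤ c := one_le_pow₀ (by simp)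
  have hc0 : 0 < c := zero_lt_one.trans_le hc1
  refine (luxNorm_le (l := c * l) (mul_pos hc0 hl) ?_).trans_lt ENNReal.coe_lt_top
  have hcc : (c : ℝ≥0∞)⁻¹ ≤ 1 := ENNReal.inv_le_one.2 (by exact_mod_cast hc1)
  have e : (fun x => g x / ((c * l : ℝ≥0) : ℝ≥0∞)) =
      fun x => (c : ℝ≥0∞)⁻¹ * (g x / (l : ℝ≥0∞)) := by
    funext x
    rw [ENNReal.coe_mul, div_eq_mul_inv, div_eq_mul_inv, ENNReal.mul_inv (by simp) (by simp)]
    ring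
  rw [e]
  refine (modular_const_mul_le hp hcc _).trans ?_
  rw [← hm, hc, ENNReal.inv_rpow, ENNReal.coe_pow, ← ENNReal.rpow_natCast, ← ENNReal.rpow_mul]
  norm_num
  rw [mul_comm, ← div_eq_mul_inv]
  exact ENNReal.div_le_of_le_mul (by simp)

theorem luxNorm_zero {n : ℕ} {p : Rn n → ℝ≥0∞} (hp : IsQuasiExponent p) :
    luxNorm p (fun _ => 0) = 0 := by
  refine le_antisymm (le_of_forall_gt_imp_ge_of_dense fun a ha => ?_) (zero_le)
  obtain ⟨l, hl0, hla⟩ := ENNReal.lt_iff_exists_nnreal_btwn.1 ha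
  refine (luxNorm_le (by exact_mod_cast hl0) ?_).trans hla.le
  simp [modular_zero hp]

theorem luxNorm_const_mul_le {n : ℕ} {p : Rn n → ℝ≥0∞} (hp : IsQuasiExponent p) {c : ℝ≥0∞}
    (hc : c ≠ ∞) (g : Rn n → ℝ≥0∞) :
    luxNorm p (fun x => c * g x) ≤ c * luxNorm p g := by
  rcases eq_or_ne c 0 with rfl | h0
  · simp [luxNorm_zero hp]
  rw [luxNorm.eq_def p g, ENNReal.mul_iInf_of_ne h0 hc]
  refine le_iInf fun l => ?_
  rw [ENNReal.mul_iInf_of_ne h0 hc]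
  refine le_iInf fun hl => ?_
  lift c to ℝ≥0 using hc
  rw [← ENNReal.coe_mul]
  refine luxNorm_le (mul_pos (by simpa [pos_iff_ne_zero] using h0) hl.1) ?_
  convert hl.2 using 3 with x
  rw [ENNReal.coe_mul, ENNReal.mul_div_mul_left _ _ h0 ENNReal.coe_ne_top]

theorem const_mul_luxNorm_le {n : ℕ} {p : Rn n → ℝ≥0∞} (hp : IsQuasiExponent p) {c : ℝ≥0∞}
    (hc : c ≠ ∞) (g : Rn n → ℝ≥0∞) :
    c * luxNorm p g ≤ luxNorm p (fun x => c * g x) := by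
  rcases eq_or_ne c 0 with rfl | h0
  · simp
  have := luxNorm_const_mul_le hp (ENNReal.inv_ne_top.2 h0) (fun x => c * g x)
  simp only [← mul_assoc, ENNReal.inv_mul_cancel h0 hc, one_mul] at this
  calc c * luxNorm p g ≤ c * (c⁻¹ * luxNorm p fun x => c * g x) := by gcongr
    _ = _ := by rw [← mul_assoc, ENNReal.mul_inv_cancel h0 hc, one_mul]

theorem ae_eq_zero_of_luxNorm_eq_zero {n : ℕ} {p g : Rn n → ℝ≥0∞} (hp : IsQuasiExponent p)
    (hg : AEMeasurable g volume) (h : luxNorm p g = 0) : g =ᵐ[volume] 0 := by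
  have key : modular p g = 0 := by
    refine le_antisymm (le_of_forall_gt_imp_ge_of_dense fun a ha => ?_) (zero_le)
    obtain ⟨l, hl0, hla⟩ := ENNReal.lt_iff_exists_nnreal_btwn.1 (lt_min ha one_pos)
    -- The norm is below l², so undoing the division by l² bounds the modular by (l²)^{1/2} = l.
    have hl1 : (l : ℝ≥0∞) ^ 2 ≤ 1 := pow_le_one₀ (zero_le) (hla.le.trans (min_le_right _ _))
    have hl2 : (l : ℝ≥0∞) ^ 2 ≠ 0 := pow_ne_zero _ hl0.ne'
    have h1 : modular p (fun x => g x / ((l ^ 2 : ℝ≥0) : ℝ≥0∞)) ≤ 1 :=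
      modular_div_le_one_of_luxNorm_lt (by rw [h]; push_cast; exact pos_iff_ne_zero.2 hl2)
    have h2 := modular_const_mul_le hp hl1 (fun x => g x / ((l ^ 2 : ℝ≥0) : ℝ≥0∞))
    simp only [ENNReal.coe_pow] at h1 h2
    simp only [ENNReal.mul_div_cancel hl2 (ENNReal.pow_ne_top ENNReal.coe_ne_top)] at h2
    calc modular p g ≤ _ := h2
      _ ≤ ((l : ℝ≥0∞) ^ 2) ^ (1 / 2 : ℝ) * 1 := by gcongr
      _ = l := by rw [mul_one, ← ENNReal.rpow_natCast, ← ENNReal.rpow_mul]; norm_num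
      _ ≤ a := hla.le.trans (min_le_left _ _)
  obtain ⟨k1, k2⟩ := add_eq_zero.1 key
  rw [lintegral_eq_zero_iff'
    ((hg.pow hp.aemeasurable.ennreal_toReal).restrict)] at k1
  have k3 := ENNReal.essSup_eq_zero_iff.1 k2
  rw [Filter.EventuallyEq, ae_restrict_iff'₀ (nullMeasurableSet_ne_top hp.aemeasurable)] at k1
  rw [Filter.EventuallyEq, ae_restrict_iff'₀ (nullMeasurableSet_eq_top hp.aemeasurable)] at k3
  filter_upwards [k1, k3] with x h1 h3
  by_cases hx : p x = ∞
  · exact h3 hx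
  · have h4 := hp.half_le_toReal hx
    exact (ENNReal.rpow_eq_zero_iff_of_pos (by linarith)).1 (h1 hx)

/-- Reduces a bound by a product of norms to one by arbitrary admissible radii, by taking infima one
at a time. It serves both Hölder's inequality and the estimate for families. -/
theorem le_mul_luxNorm_mul_luxNorm {n : ℕ} {p q g k : Rn n → ℝ≥0∞} {X C : ℝ≥0∞} (hC : C ≠ 0)
    (hC' : C ≠ ∞) (hq : luxNorm q k ≠ ∞)
    (H : ∀ l m : ℝ≥0, 0 < l → 0 < m → modular p (fun x => g x / (l : ℝ≥0∞)) ≤ 1 →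
      modular q (fun x => k x / (m : ℝ≥0∞)) ≤ 1 → X ≤ C * l * m)
    (hp : luxNorm p g ≠ ∞) : X ≤ C * luxNorm p g * luxNorm q k := by
  have h1 : ∀ l : ℝ≥0, 0 < l → modular p (fun x => g x / (l : ℝ≥0∞)) ≤ 1 →
      X ≤ C * l * luxNorm q k := by
    intro l hl hl1
    have h0 : C * l ≠ 0 := mul_ne_zero hC (by simpa using hl.ne')
    have h2 : C * l ≠ ∞ := ENNReal.mul_ne_top hC' ENNReal.coe_ne_top
    rw [luxNorm, ENNReal.mul_iInf_of_ne h0 h2]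
    refine le_iInf fun m => ?_
    rw [ENNReal.mul_iInf_of_ne h0 h2]
    exact le_iInf fun hm => H l m hl hm.1 hl1 hm.2
  -- Pulling a factor through an infimum requires it to be nonzero and finite, so a vanishing second
  -- norm is handled apart, with any one admissible l.
  rcases eq_or_ne (luxNorm q k) 0 with h0 | h0
  · obtain ⟨l, hl⟩ : ∃ l : ℝ≥0, luxNorm p g < l := ENNReal.lt_iff_exists_nnreal_btwn.1
      (lt_top_iff_ne_top.2 hp) |>.imp fun _ h => h.1
    have := h1 l (by exact_mod_cast (zero_le.trans_lt hl)) (modular_div_le_one_of_luxNorm_lt hl)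
    simpa [h0] using this
  · have h3 : C * luxNorm q k ≠ 0 := mul_ne_zero hC h0
    have h4 : C * luxNorm q k ≠ ∞ := ENNReal.mul_ne_top hC' hq
    rw [mul_right_comm, luxNorm.eq_def p g, ENNReal.mul_iInf_of_ne h3 h4]
    refine le_iInf fun l => ?_
    rw [ENNReal.mul_iInf_of_ne h3 h4]
    refine le_iInf fun hl => ?_
    rw [mul_right_comm]
    exact h1 l hl.1 hl.2

/-! ### Hölder's inequality and the norm conjugate formula -/

theorem IsExponent.dualExp_eq_one_iff {n : ℕ} {p : Rn n → ℝ≥0∞} (hp : IsExponent p) {x : Rn n} :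
    dualExp p x = 1 ↔ p x = ∞ := by
  have h := hp.inv_add_inv_dualExp x
  constructor
  · intro h1
    rw [h1, inv_one] at h
    have : (p x)⁻¹ = 0 := by
      simpa using (ENNReal.add_left_inj ENNReal.one_ne_top).1 (h.trans (zero_add 1).symm)
    simpa using this
  · intro h1
    simpa [h1] using h

theorem IsExponent.dualExp_eq_top_iff {n : ℕ} {p : Rn n → ℝ≥0∞} (hp : IsExponent p) {x : Rn n} :
    dualExp p x = ∞ ↔ p x = 1 := by
  have h := hp.inv_add_inv_dualExp x
  constructor
  · intro h1
    simpa [h1] using h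
  · intro h1
    simp [dualExp, h1]

theorem IsExponent.holderConjugate {n : ℕ} {p : Rn n → ℝ≥0∞} (hp : IsExponent p) {x : Rn n}
    (h1 : p x ≠ 1) (h2 : p x ≠ ∞) : (p x).toReal.HolderConjugate (dualExp p x).toReal := by
  rw [Real.holderConjugate_iff]
  have h3 : dualExp p x ≠ ∞ := fun h => h1 (hp.dualExp_eq_top_iff.1 h)
  constructor
  · have := (ENNReal.toReal_lt_toReal ENNReal.one_ne_top h2).2
      (lt_of_le_of_ne (hp.one_le x) (Ne.symm h1))
    simpa using this
  · have h := congrArg ENNReal.toReal (hp.inv_add_inv_dualExp x)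
    have h4 : (p x)⁻¹ ≠ ∞ := ENNReal.inv_ne_top.2 (zero_lt_one.trans_le (hp.one_le x)).ne'
    have h5 : (dualExp p x)⁻¹ ≠ ∞ :=
      ENNReal.inv_ne_top.2 (zero_lt_one.trans_le (hp.dualExp_isExponent.one_le x)).ne'
    rwa [ENNReal.toReal_add h4 h5, ENNReal.toReal_inv, ENNReal.toReal_inv, ENNReal.toReal_one] at h

theorem ae_le_one_of_modular_le_one {n : ℕ} {p u : Rn n → ℝ≥0∞} (hp : IsQuasiExponent p)
    (h : modular p u ≤ 1) : ∀ᵐ x, p x = ∞ → u x ≤ 1 := by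
  refine (ae_restrict_iff'₀ (nullMeasurableSet_eq_top hp.aemeasurable)).1 ?_
  filter_upwards [ENNReal.ae_le_essSup u] with x hx
  exact hx.trans (le_add_self.trans h)

/-- Hölder's inequality in variable Lebesgue spaces, normalized form. -/
theorem lintegral_mul_le_two {n : ℕ} {p u v : Rn n → ℝ≥0∞} (hp : IsExponent p)
    (hu : AEMeasurable u volume) (h1 : modular p u ≤ 1)
    (h2 : modular (dualExp p) v ≤ 1) : ∫⁻ x, u x * v x ≤ 2 := by
  have hq := hp.dualExp_isExponent
  -- Young's inequality pointwise, with its factors 1/p and 1/p' dropped. Where p = ∞ or p = 1, one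
  -- function is at most 1 and the other carries the exponent 1.
  have key : ∀ᵐ x, u x * v x ≤ {x | p x ≠ ∞}.indicator (fun x => u x ^ (p x).toReal) x +
      {x | dualExp p x ≠ ∞}.indicator (fun x => v x ^ (dualExp p x).toReal) x := by
    filter_upwards [ae_le_one_of_modular_le_one hp.isQuasiExponent h1,
      ae_le_one_of_modular_le_one hq.isQuasiExponent h2] with x hx1 hx2
    by_cases ht : p x = ∞
    · have h1' := hp.dualExp_eq_one_iff.2 ht
      simpa [ht, h1'] using mul_le_mul_left (hx1 ht) (v x)
    by_cases ho : p x = 1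
    · have h1' := hp.dualExp_eq_top_iff.2 ho
      simpa [ho, h1'] using mul_le_mul_right (hx2 h1') (u x)
    have h3 : dualExp p x ≠ ∞ := fun h => ho (hp.dualExp_eq_top_iff.1 h)
    have hc := hp.holderConjugate ho ht
    rw [Set.indicator_of_mem (by exact ht), Set.indicator_of_mem (by exact h3)]
    refine (ENNReal.young_inequality (u x) (v x) hc).trans (add_le_add ?_ ?_)
    · exact ENNReal.div_le_of_le_mul (le_mul_of_one_le_right (zero_le)
        (by simpa using hc.lt.le))
    · exact ENNReal.div_le_of_le_mul (le_mul_of_one_le_right (zero_le)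
        (by simpa using hc.symm.lt.le))
  refine (lintegral_mono_ae key).trans ?_
  rw [lintegral_add_left', lintegral_indicator₀ (nullMeasurableSet_ne_top hp.aemeasurable),
    lintegral_indicator₀ (nullMeasurableSet_ne_top hq.aemeasurable)]
  · exact (add_le_add (le_self_add.trans h1) (le_self_add.trans h2)).trans_eq one_add_one_eq_two
  · exact (hu.pow hp.aemeasurable.ennreal_toReal).indicator₀
      (nullMeasurableSet_ne_top hp.aemeasurable)

/-- Hölder's inequality in variable Lebesgue spaces. -/
theorem lintegral_mul_le_luxNorm {n : ℕ} {p u v : Rn n → ℝ≥0∞} (hp : IsExponent p)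
    (hu : AEMeasurable u volume) (h1 : luxNorm p u ≠ ∞) (h2 : luxNorm (dualExp p) v ≠ ∞) :
    ∫⁻ x, u x * v x ≤ 2 * luxNorm p u * luxNorm (dualExp p) v := by
  refine le_mul_luxNorm_mul_luxNorm two_ne_zero ENNReal.ofNat_ne_top h2 ?_ h1
  intro l m hl hm hl1 hm1
  have hl0 : (l : ℝ≥0∞) ≠ 0 := by simpa using hl.ne'
  have hm0 : (m : ℝ≥0∞) ≠ 0 := by simpa using hm.ne'
  have := lintegral_mul_le_two hp (hu.div_const _) hl1 hm1
  have e : ∀ x, u x * v x = (l * m : ℝ≥0∞) * (u x / l * (v x / m)) := fun x => by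
    rw [mul_mul_mul_comm, ENNReal.mul_div_cancel hl0 ENNReal.coe_ne_top,
      ENNReal.mul_div_cancel hm0 ENNReal.coe_ne_top]
  simp_rw [e]
  rw [lintegral_const_mul' _ _ (ENNReal.mul_ne_top ENNReal.coe_ne_top ENNReal.coe_ne_top)]
  calc _ ≤ (l * m : ℝ≥0∞) * 2 := by gcongr
    _ = _ := by ring

/-- A finite measurable minorant whose integral is finite and exceeds a given bound. -/
theorem exists_measurable_le_lt_lintegral {n : ℕ} {φ : Rn n → ℝ≥0∞} (hφ : AEMeasurable φ volume)
    {L : ℝ≥0∞} (hL : L < ∫⁻ x, φ x) :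
    ∃ ψ : Rn n → ℝ≥0∞, Measurable ψ ∧ (∀ x, ψ x ≠ ∞) ∧ (∀ᵐ x, ψ x ≤ φ x) ∧
      ∫⁻ x, ψ x ≠ ∞ ∧ L < ∫⁻ x, ψ x := by
  rw [lintegral_congr_ae hφ.ae_eq_mk, lintegral_eq_nnreal] at hL
  simp only [lt_iSup_iff] at hL
  obtain ⟨χ, hχ, hL⟩ := hL
  rw [← SimpleFunc.lintegral_eq_lintegral] at hL
  obtain ⟨ψ, h1, h2, h3⟩ := SimpleFunc.exists_lt_lintegral_simpleFunc_of_lt_lintegral hL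
  refine ⟨fun x => ψ x, ψ.measurable.coe_nnreal_ennreal, fun x => ENNReal.coe_ne_top, ?_, h2.ne, h3⟩
  filter_upwards [hφ.ae_eq_mk] with x hx
  rw [hx]
  exact (ENNReal.coe_le_coe.2 (h1 x)).trans (hχ x)

/-- Norm conjugate formula: norms in `L^{p'(·)}` are detected by pairing with the unit ball of
`L^{p(·)}`. -/
theorem exists_le_lintegral_mul {n : ℕ} {p g : Rn n → ℝ≥0∞} (hp : IsExponent p)
    (hg : AEMeasurable g volume) {a : ℝ≥0} (ha : a < luxNorm (dualExp p) g) :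
    ∃ h : Rn n → ℝ≥0∞, AEMeasurable h volume ∧ (∀ x, h x ≠ ∞) ∧ modular p h ≤ 1 ∧
      a ≤ 3 * ∫⁻ x, h x * g x := by
  have hq := hp.dualExp_isExponent
  rcases eq_zero_or_pos a with rfl | ha0
  · exact ⟨fun _ => 0, aemeasurable_const, by simp, by simp [modular_zero hp.isQuasiExponent],
      by simp⟩
  have ha0' : (a : ℝ≥0∞) ≠ 0 := by simpa using ha0.ne'
  have h1 : 1 < modular (dualExp p) (fun x => g x / (a : ℝ≥0∞)) := by
    by_contra! h
    exact absurd (luxNorm_le ha0 h) (not_le.2 ha)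
  -- The modular exceeds 1, so its integral part or its supremum part exceeds 1/2.
  have h2 : 2⁻¹ < ∫⁻ x in {x | dualExp p x ≠ ∞}, (g x / a) ^ (dualExp p x).toReal ∨
      2⁻¹ < essSup (fun x => g x / (a : ℝ≥0∞)) (volume.restrict {x | dualExp p x = ∞}) := by
    by_contra! h
    refine absurd (add_le_add h.1 h.2) (not_le.2 ?_)
    rwa [ENNReal.inv_two_add_inv_two]
  have hga : AEMeasurable (fun x => g x / (a : ℝ≥0∞)) volume := hg.div_const _
  rcases h2 with h2 | h2
  · rw [← lintegral_indicator₀ (nullMeasurableSet_ne_top hq.aemeasurable)] at h2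
    obtain ⟨ψ, hψm, hψt, hψle, hI, hI2⟩ := exists_measurable_le_lt_lintegral
      ((hga.pow hq.aemeasurable.ennreal_toReal).indicator₀
      (nullMeasurableSet_ne_top hq.aemeasurable)) h2
    set I := ∫⁻ x, ψ x with hIdef
    have hM0 : (1 + I) ≠ 0 := by simp
    have hMt : (1 + I) ≠ ∞ := ENNReal.add_ne_top.2 ⟨ENNReal.one_ne_top, hI⟩
    have hM1 : (1 + I)⁻¹ ≤ 1 := ENNReal.inv_le_one.2 le_self_add
    -- Here ψ ≤ (g/a)^{p'} has finite integral I, even if that of (g/a)^{p'} is infinite. The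
    -- function ψ^{1/p} is the usual extremizer; the integral part of its scaled modular is at most
    -- I/(1+I), and the supremum part at most 1/(1+I), since ψ⁰ = 1 where p = ∞.
    refine ⟨fun x => (1 + I)⁻¹ * ψ x ^ ((p x)⁻¹).toReal, ?_, ?_, ?_, ?_⟩
    · exact (hψm.aemeasurable.pow hp.aemeasurable.inv.ennreal_toReal).const_mul _
    · exact fun x => ENNReal.mul_ne_top (ENNReal.inv_ne_top.2 hM0)
        (ENNReal.rpow_ne_top_of_nonneg ENNReal.toReal_nonneg (hψt x))
    · have b1 : (∫⁻ x in {x | p x ≠ ∞},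
          ((1 + I)⁻¹ * ψ x ^ ((p x)⁻¹).toReal) ^ (p x).toReal) ≤ (1 + I)⁻¹ * I := by
        rw [hIdef, ← lintegral_const_mul _ hψm]
        refine le_trans (lintegral_mono_ae ?_) (setLIntegral_le_lintegral {x | p x ≠ ∞} _)
        filter_upwards [ae_restrict_mem₀ (nullMeasurableSet_ne_top hp.aemeasurable)] with x hx
        have hp1 : 1 ≤ (p x).toReal := by
          simpa using ENNReal.toReal_mono hx (hp.one_le x)
        rw [ENNReal.mul_rpow_of_nonneg _ _ ENNReal.toReal_nonneg, ← ENNReal.rpow_mul,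
          ENNReal.toReal_inv, inv_mul_cancel₀ (by linarith), ENNReal.rpow_one]
        gcongr ?_ * _
        calc _ ≤ (1 + I)⁻¹ ^ (1 : ℝ) := ENNReal.rpow_le_rpow_of_exponent_ge hM1 hp1
          _ = _ := ENNReal.rpow_one _
      have b2 : essSup (fun x => (1 + I)⁻¹ * ψ x ^ ((p x)⁻¹).toReal)
          (volume.restrict {x | p x = ∞}) ≤ (1 + I)⁻¹ := by
        refine essSup_le_of_ae_le _ ?_
        filter_upwards [ae_restrict_mem₀ (nullMeasurableSet_eq_top hp.aemeasurable)] with x hx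
        simp [show p x = ∞ from hx]
      calc modular p _ ≤ (1 + I)⁻¹ * I + (1 + I)⁻¹ := add_le_add b1 b2
        _ = (1 + I)⁻¹ * (1 + I) := by ring
        _ = 1 := ENNReal.inv_mul_cancel hM0 hMt
    · have c1 : (1 + I)⁻¹ * a * I ≤ ∫⁻ x, (1 + I)⁻¹ * ψ x ^ ((p x)⁻¹).toReal * g x := by
        rw [hIdef, ← lintegral_const_mul _ hψm]
        refine lintegral_mono_ae ?_
        filter_upwards [hψle] with x hx
        rw [mul_assoc, mul_assoc]
        gcongr (1 + I)⁻¹ * ?_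
        by_cases ht : dualExp p x = ∞
        · simp [ht] at hx
          simp [hx]
        have ht' : x ∈ {x | dualExp p x ≠ ∞} := ht
        rw [Set.indicator_of_mem ht'] at hx
        have hq1 : 1 ≤ (dualExp p x).toReal := by
          simpa using ENNReal.toReal_mono ht (hq.one_le x)
        have e1 : ψ x = ψ x ^ ((p x)⁻¹).toReal * ψ x ^ ((dualExp p x)⁻¹).toReal := by
          rw [← ENNReal.rpow_add_of_nonneg _ _ ENNReal.toReal_nonneg ENNReal.toReal_nonneg,
            ← ENNReal.toReal_add, hp.inv_add_inv_dualExp, ENNReal.toReal_one, ENNReal.rpow_one]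
          · exact ENNReal.inv_ne_top.2 (zero_lt_one.trans_le (hp.one_le x)).ne'
          · exact ENNReal.inv_ne_top.2 (zero_lt_one.trans_le (hq.one_le x)).ne'
        have e2 : ψ x ^ ((dualExp p x)⁻¹).toReal ≤ g x / a := by
          refine (ENNReal.rpow_le_rpow hx ENNReal.toReal_nonneg).trans ?_
          rw [← ENNReal.rpow_mul, ENNReal.toReal_inv, mul_inv_cancel₀ (by linarith),
            ENNReal.rpow_one]
        calc a * ψ x = ψ x ^ ((p x)⁻¹).toReal * (a * ψ x ^ ((dualExp p x)⁻¹).toReal) := by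
              conv_lhs => rw [e1]
              ring
          _ ≤ ψ x ^ ((p x)⁻¹).toReal * (a * (g x / a)) := by gcongr
          _ = _ := by rw [ENNReal.mul_div_cancel ha0' ENNReal.coe_ne_top]
      -- I > 1/2 forces I/(1+I) ≥ 1/3, the source of the constant 3.
      have c2 : 1 ≤ 3 * ((1 + I)⁻¹ * I) := by
        have : 1 ≤ 2 * I := by
          calc (1 : ℝ≥0∞) = 2 * 2⁻¹ := (ENNReal.mul_inv_cancel two_ne_zero ENNReal.ofNat_ne_top).symm
            _ ≤ 2 * I := by gcongr
        calc (1 : ℝ≥0∞) = (1 + I)⁻¹ * (1 + I) := (ENNReal.inv_mul_cancel hM0 hMt).symm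
          _ ≤ (1 + I)⁻¹ * (2 * I + I) := by gcongr
          _ = _ := by ring
      calc (a : ℝ≥0∞) = a * 1 := (mul_one _).symm
        _ ≤ a * (3 * ((1 + I)⁻¹ * I)) := by gcongr
        _ = 3 * ((1 + I)⁻¹ * a * I) := by ring
        _ ≤ _ := by gcongr
  -- On {p' = ∞} = {p = 1}, the test function is a normalized ψ ≤ χ_E, with E the set where g > a/2.
  -- Passing to ψ covers sets E of infinite measure.
  · set E : Set (Rn n) := {x | dualExp p x = ∞} ∩ {x | 2⁻¹ < g x / (a : ℝ≥0∞)} with hE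
    have hEm : NullMeasurableSet E volume :=
      (nullMeasurableSet_eq_top hq.aemeasurable).inter
        (hga.nullMeasurableSet_preimage measurableSet_Ioi)
    have hE0 : 0 < ∫⁻ x, E.indicator 1 x := by
      rw [lintegral_indicator_one₀ hEm, pos_iff_ne_zero]
      intro h0
      refine absurd (essSup_le_of_ae_le (2⁻¹ : ℝ≥0∞) ?_) (not_le.2 h2)
      refine (ae_restrict_iff'₀ (nullMeasurableSet_eq_top hq.aemeasurable)).2 ?_
      have : ∀ᵐ x, x ∉ E := measure_eq_zero_iff_ae_notMem.1 h0
      filter_upwards [this] with x hx hx2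
      by_contra! h3
      exact hx ⟨hx2, h3⟩
    obtain ⟨ψ, hψm, hψt, hψle, hI, hI0⟩ := exists_measurable_le_lt_lintegral
      ((aemeasurable_const (b := (1 : ℝ≥0∞))).indicator₀ hEm) hE0
    set I := ∫⁻ x, ψ x with hIdef
    have hIt : I⁻¹ ≠ ∞ := ENNReal.inv_ne_top.2 hI0.ne'
    have hone : ∀ x ∈ E, p x = 1 := fun x hx => hp.dualExp_eq_top_iff.1 hx.1
    have hout : ∀ᵐ x, x ∉ E → ψ x = 0 := by
      filter_upwards [hψle] with x hx hxE
      simpa [hxE] using hx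
    refine ⟨fun x => I⁻¹ * ψ x, (hψm.const_mul _).aemeasurable,
      fun x => ENNReal.mul_ne_top hIt (hψt x), ?_, ?_⟩
    · have b1 : (∫⁻ x in {x | p x ≠ ∞}, (I⁻¹ * ψ x) ^ (p x).toReal) ≤ I⁻¹ * I := by
        rw [hIdef, ← lintegral_const_mul _ hψm]
        refine le_trans (lintegral_mono_ae ?_) (setLIntegral_le_lintegral {x | p x ≠ ∞} _)
        filter_upwards [ae_restrict_mem₀ (nullMeasurableSet_ne_top hp.aemeasurable),
          ae_restrict_of_ae hout] with x hx hx2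
        by_cases hxE : x ∈ E
        · simp [hone x hxE]
        · have hp1 : 0 < (p x).toReal :=
            ENNReal.toReal_pos (zero_lt_one.trans_le (hp.one_le x)).ne' hx
          simp [hx2 hxE, hp1]
      have b2 : essSup (fun x => I⁻¹ * ψ x) (volume.restrict {x | p x = ∞}) ≤ 0 := by
        refine essSup_le_of_ae_le _ ?_
        filter_upwards [ae_restrict_mem₀ (nullMeasurableSet_eq_top hp.aemeasurable),
          ae_restrict_of_ae hout] with x hx hx2
        have : x ∉ E := fun h => by
          have := (hone x h).symm.trans hx
          simp at this
        simp [hx2 this]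
      calc modular p _ ≤ I⁻¹ * I + 0 := add_le_add b1 b2
        _ = 1 := by rw [add_zero, ENNReal.inv_mul_cancel hI0.ne' hI]
    · have c1 : I⁻¹ * (a * 2⁻¹) * I ≤ ∫⁻ x, I⁻¹ * ψ x * g x := by
        rw [hIdef, ← lintegral_const_mul _ hψm]
        refine lintegral_mono_ae ?_
        filter_upwards [hout] with x hx
        by_cases hxE : x ∈ E
        · calc I⁻¹ * (a * 2⁻¹) * ψ x ≤ I⁻¹ * (a * (g x / a)) * ψ x := by
                gcongr
                exact hxE.2.le
            _ = I⁻¹ * ψ x * g x := by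
                rw [ENNReal.mul_div_cancel ha0' ENNReal.coe_ne_top]
                ring
        · simp [hx hxE]
      calc (a : ℝ≥0∞) = 2 * 2⁻¹ * a := by
            rw [ENNReal.mul_inv_cancel two_ne_zero ENNReal.ofNat_ne_top, one_mul]
        _ ≤ 3 * 2⁻¹ * a := by gcongr; norm_num
        _ = 3 * (I⁻¹ * (a * 2⁻¹) * I) := by
            rw [mul_comm I⁻¹, mul_assoc _ I⁻¹, ENNReal.inv_mul_cancel hI0.ne' hI]
            ring
        _ ≤ _ := by gcongr

/-! ### Cubes, averages and local Hölder bounds -/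

theorem measurableSet_cube {n : ℕ} (a : Rn n) (l : ℝ) :
    MeasurableSet {x : Rn n | ∀ i, a i ≤ x i ∧ x i < a i + l} := by
  have : {x : Rn n | ∀ i, a i ≤ x i ∧ x i < a i + l} =
      ⋂ i, ({x : Rn n | a i ≤ x i} ∩ {x | x i < a i + l}) := by
    ext x
    simp
  rw [this]
  exact MeasurableSet.iInter fun i =>
    (measurableSet_le measurable_const (by fun_prop)).inter
      (measurableSet_lt (by fun_prop) measurable_const)

theorem volume_cube {n : ℕ} (a : Rn n) (l : ℝ) :
    volume {x : Rn n | ∀ i, a i ≤ x i ∧ x i < a i + l} = ENNReal.ofReal l ^ n := by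
  have : {x : Rn n | ∀ i, a i ≤ x i ∧ x i < a i + l} = (@WithLp.ofLp 2 (Fin n → ℝ)) ⁻¹'
      (Set.pi Set.univ fun i => Set.Ico (a i) (a i + l)) := by
    ext x
    simp
  rw [this, (PiLp.volume_preserving_ofLp (Fin n)).measure_preimage
    (MeasurableSet.univ_pi fun _ => measurableSet_Ico).nullMeasurableSet, Real.volume_pi_Ico]
  simp

theorem IsCube.measurableSet {n : ℕ} {Q : Set (Rn n)} (hQ : IsCube Q) : MeasurableSet Q := by
  obtain ⟨a, l, -, rfl⟩ := hQ
  exact measurableSet_cube a l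

theorem IsCube.volume_ne_zero {n : ℕ} {Q : Set (Rn n)} (hQ : IsCube Q) : volume Q ≠ 0 := by
  obtain ⟨a, l, hl, rfl⟩ := hQ
  rw [volume_cube]
  exact pow_ne_zero _ (by simpa using hl)

theorem IsCube.volume_ne_top {n : ℕ} {Q : Set (Rn n)} (hQ : IsCube Q) : volume Q ≠ ∞ := by
  obtain ⟨a, l, hl, rfl⟩ := hQ
  rw [volume_cube]
  exact ENNReal.pow_ne_top ENNReal.ofReal_ne_top

theorem IsCube.enorm_volume_real_inv {n : ℕ} {Q : Set (Rn n)} (hQ : IsCube Q) :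
    ‖(volume.real Q)⁻¹‖ₑ = (volume Q)⁻¹ := by
  rw [enorm_inv (by simp [measureReal_def, ENNReal.toReal_eq_zero_iff, hQ.volume_ne_zero,
    hQ.volume_ne_top]), measureReal_def, Real.enorm_of_nonneg ENNReal.toReal_nonneg,
    ENNReal.ofReal_toReal hQ.volume_ne_top]

theorem enorm_setAverage_le {n : ℕ} {Q : Set (Rn n)} (hQ : IsCube Q) (f : Rn n → ℂ) :
    ‖⨍ x in Q, f x‖ₑ ≤ (volume Q)⁻¹ * ∫⁻ x in Q, ‖f x‖ₑ := by
  rw [setAverage_eq, enorm_smul, hQ.enorm_volume_real_inv]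
  gcongr
  exact enorm_integral_le_lintegral_enorm f

/-- Local version of Hölder's inequality with a weight. -/
theorem setLIntegral_enorm_le {n : ℕ} {p w : Rn n → ℝ≥0∞} (hp : IsExponent p) (hw : IsWeight w)
    {f : Rn n → ℂ} (hf : AEStronglyMeasurable f volume) {Q : Set (Rn n)} (hQ : MeasurableSet Q)
    (h1 : luxNorm p (Q.indicator fun x => ‖f x‖ₑ * w x) ≠ ∞)
    (h2 : luxNorm (dualExp p) (Q.indicator fun x => (w x)⁻¹) ≠ ∞) :
    ∫⁻ x in Q, ‖f x‖ₑ ≤ 2 * luxNorm p (Q.indicator fun x => ‖f x‖ₑ * w x) *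
      luxNorm (dualExp p) (Q.indicator fun x => (w x)⁻¹) := by
  refine le_trans (le_of_eq ?_) (lintegral_mul_le_luxNorm hp
    ((hf.enorm.mul hw.aemeasurable).indicator hQ) h1 h2)
  rw [← lintegral_indicator hQ]
  refine lintegral_congr_ae ?_
  filter_upwards [hw.pos, hw.lt_top] with x h3 h4
  by_cases hx : x ∈ Q
  · simp only [Set.indicator_of_mem hx, mul_assoc, ENNReal.mul_inv_cancel h3.ne' h4.ne, mul_one]
  · simp [hx]

theorem luxNorm_indicator_le {n : ℕ} (p g : Rn n → ℝ≥0∞) (Q : Set (Rn n)) :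
    luxNorm p (Q.indicator g) ≤ luxNorm p g :=
  luxNorm_mono_ae (Filter.Eventually.of_forall fun x => Set.indicator_le_self' (by simp) x)

theorem MemWeighted.weightedNorm_lt_top {n : ℕ} {p w : Rn n → ℝ≥0∞} {f : Rn n → ℂ}
    (hp : IsQuasiExponent p) (hf : MemWeighted p w f) : weightedNorm p w f < ∞ := by
  obtain ⟨-, l, hl, h⟩ := hf
  exact luxNorm_lt_top hp hl h

/-- Cubes have positive measure. This excludes products 0 · ∞ in the weight condition, so that
finiteness of the product gives finiteness of each norm. -/
theorem luxNorm_indicator_ne_zero {n : ℕ} {p v : Rn n → ℝ≥0∞} (hp : IsQuasiExponent p)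
    (hv : AEMeasurable v volume) (hv0 : ∀ᵐ x, v x ≠ 0) {Q : Set (Rn n)} (hQ : IsCube Q) :
    luxNorm p (Q.indicator v) ≠ 0 := by
  intro h
  have h1 := ae_eq_zero_of_luxNorm_eq_zero hp (hv.indicator hQ.measurableSet) h
  refine hQ.volume_ne_zero (measure_eq_zero_iff_ae_notMem.2 ?_)
  filter_upwards [h1, hv0] with x hx hx0 hxQ
  exact hx0 (by simpa [hxQ] using hx)

/-! ### The weight condition and single averages -/

/-- The bilinear Muckenhoupt condition, unfolded: the three norms are nontrivial, and their
normalized product is bounded uniformly over the cubes. -/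
theorem BilinearAp.exists_bound {n : ℕ} {p₁ p₂ w₁ w₂ : Rn n → ℝ≥0∞}
    (hp₁ : IsExponent p₁) (hp₂ : IsExponent p₂) (hw₁ : IsWeight w₁) (hw₂ : IsWeight w₂)
    (h : BilinearAp p₁ p₂ w₁ w₂) :
    ∃ K : ℝ≥0, ∀ Q : Set (Rn n), IsCube Q →
      luxNorm (sumExp p₁ p₂) (Q.indicator fun x => w₁ x * w₂ x) ≠ 0 ∧
      luxNorm (sumExp p₁ p₂) (Q.indicator fun x => w₁ x * w₂ x) ≠ ∞ ∧
      luxNorm (dualExp p₁) (Q.indicator fun x => (w₁ x)⁻¹) ≠ ∞ ∧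
      luxNorm (dualExp p₂) (Q.indicator fun x => (w₂ x)⁻¹) ≠ ∞ ∧
      ((volume Q) ^ 2)⁻¹
        * luxNorm (sumExp p₁ p₂) (Q.indicator fun x => w₁ x * w₂ x)
        * luxNorm (dualExp p₁) (Q.indicator fun x => (w₁ x)⁻¹)
        * luxNorm (dualExp p₂) (Q.indicator fun x => (w₂ x)⁻¹) ≤ K := by
  unfold BilinearAp at h
  refine ⟨(⨆ (Q : Set (Rn n)) (_ : IsCube Q),
    ((volume Q) ^ 2)⁻¹
      * luxNorm (sumExp p₁ p₂) (Q.indicator fun x => w₁ x * w₂ x)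
      * luxNorm (dualExp p₁) (Q.indicator fun x => (w₁ x)⁻¹)
      * luxNorm (dualExp p₂) (Q.indicator fun x => (w₂ x)⁻¹)).toNNReal, fun Q hQ => ?_⟩
  rw [ENNReal.coe_toNNReal h.ne]
  have hle := le_iSup₂ (f := fun (Q : Set (Rn n)) (_ : IsCube Q) => ((volume Q) ^ 2)⁻¹
      * luxNorm (sumExp p₁ p₂) (Q.indicator fun x => w₁ x * w₂ x)
      * luxNorm (dualExp p₁) (Q.indicator fun x => (w₁ x)⁻¹)
      * luxNorm (dualExp p₂) (Q.indicator fun x => (w₂ x)⁻¹)) Q hQ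
  have hfin := (hle.trans_lt h).ne
  have hV : ((volume Q) ^ 2)⁻¹ ≠ 0 :=
    ENNReal.inv_ne_zero.2 (ENNReal.pow_ne_top hQ.volume_ne_top)
  have h0 : luxNorm (sumExp p₁ p₂) (Q.indicator fun x => w₁ x * w₂ x) ≠ 0 :=
    luxNorm_indicator_ne_zero (hp₁.sumExp_isQuasiExponent hp₂)
      (hw₁.aemeasurable.mul hw₂.aemeasurable)
      (by filter_upwards [hw₁.pos, hw₂.pos] with x h1 h2 using mul_ne_zero h1.ne' h2.ne') hQ
  have h1 : luxNorm (dualExp p₁) (Q.indicator fun x => (w₁ x)⁻¹) ≠ 0 :=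
    luxNorm_indicator_ne_zero hp₁.dualExp_isExponent.isQuasiExponent hw₁.aemeasurable.inv
      (by filter_upwards [hw₁.lt_top] with x h1 using ENNReal.inv_ne_zero.2 h1.ne) hQ
  have h2 : luxNorm (dualExp p₂) (Q.indicator fun x => (w₂ x)⁻¹) ≠ 0 :=
    luxNorm_indicator_ne_zero hp₂.dualExp_isExponent.isQuasiExponent hw₂.aemeasurable.inv
      (by filter_upwards [hw₂.lt_top] with x h1 using ENNReal.inv_ne_zero.2 h1.ne) hQ
  refine ⟨h0, fun h => hfin ?_, fun h => hfin ?_, fun h => hfin ?_, hle⟩ <;> simp only [h]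
  · rw [ENNReal.mul_top hV, ENNReal.top_mul h1, ENNReal.top_mul h2]
  · rw [ENNReal.mul_top (mul_ne_zero hV h0), ENNReal.top_mul h2]
  · rw [ENNReal.mul_top (mul_ne_zero (mul_ne_zero hV h0) h1)]

theorem avgBounded_of_bilinearAp {n : ℕ} {p₁ p₂ w₁ w₂ : Rn n → ℝ≥0∞}
    (hp₁ : IsExponent p₁) (hp₂ : IsExponent p₂) (hw₁ : IsWeight w₁) (hw₂ : IsWeight w₂)
    (h : BilinearAp p₁ p₂ w₁ w₂) : AvgBounded p₁ p₂ w₁ w₂ := by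
  obtain ⟨K, hK⟩ := h.exists_bound hp₁ hp₂ hw₁ hw₂
  -- One factor 2 from each application of Hölder's inequality.
  refine ⟨4 * K, fun f₁ f₂ hf₁ hf₂ Q hQ => ?_⟩
  obtain ⟨h0, h0', h1, h2, hle⟩ := hK Q hQ
  have hp := hp₁.sumExp_isQuasiExponent hp₂
  have n1 := luxNorm_indicator_le p₁ (fun x => ‖f₁ x‖ₑ * w₁ x) Q
  have n2 := luxNorm_indicator_le p₂ (fun x => ‖f₂ x‖ₑ * w₂ x) Q
  have t1 := (hf₁.weightedNorm_lt_top hp₁.isQuasiExponent)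
  have t2 := (hf₂.weightedNorm_lt_top hp₂.isQuasiExponent)
  have i1 := setLIntegral_enorm_le hp₁ hw₁ hf₁.1 hQ.measurableSet (n1.trans_lt t1).ne h1
  have i2 := setLIntegral_enorm_le hp₂ hw₂ hf₂.1 hQ.measurableSet (n2.trans_lt t2).ne h2
  set N₁ := luxNorm (dualExp p₁) (Q.indicator fun x => (w₁ x)⁻¹)
  set N₂ := luxNorm (dualExp p₂) (Q.indicator fun x => (w₂ x)⁻¹)
  have i1' : ∫⁻ x in Q, ‖f₁ x‖ₑ ≤ 2 * weightedNorm p₁ w₁ f₁ * N₁ :=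
    i1.trans (by gcongr; exact n1)
  have i2' : ∫⁻ x in Q, ‖f₂ x‖ₑ ≤ 2 * weightedNorm p₂ w₂ f₂ * N₂ :=
    i2.trans (by gcongr; exact n2)
  have j1 : 2 * weightedNorm p₁ w₁ f₁ * N₁ ≠ ∞ := by finiteness
  have j2 : 2 * weightedNorm p₂ w₂ f₂ * N₂ ≠ ∞ := by finiteness
  refine ⟨⟨hf₁.1.restrict, i1'.trans_lt j1.lt_top⟩, ⟨hf₂.1.restrict, i2'.trans_lt j2.lt_top⟩, ?_⟩
  set c := (volume Q)⁻¹ * (2 * weightedNorm p₁ w₁ f₁ * N₁) *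
    ((volume Q)⁻¹ * (2 * weightedNorm p₂ w₂ f₂ * N₂)) with hc
  have hV : (volume Q)⁻¹ ≠ ∞ := ENNReal.inv_ne_top.2 hQ.volume_ne_zero
  have hct : c ≠ ∞ := by finiteness
  have hpt : ∀ x, ‖avgOp Q f₁ f₂ x‖ₑ * (w₁ x * w₂ x) ≤
      c * Q.indicator (fun x => w₁ x * w₂ x) x := by
    intro x
    by_cases hx : x ∈ Q
    · simp only [avgOp, Set.indicator_of_mem hx, enorm_mul]
      gcongr
      exact mul_le_mul' ((enorm_setAverage_le hQ f₁).trans (by gcongr))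
        ((enorm_setAverage_le hQ f₂).trans (by gcongr))
    · simp [avgOp, hx]
  calc weightedNorm (sumExp p₁ p₂) (fun x => w₁ x * w₂ x) (avgOp Q f₁ f₂)
      ≤ c * luxNorm (sumExp p₁ p₂) (Q.indicator fun x => w₁ x * w₂ x) :=
        (luxNorm_mono_ae (Filter.Eventually.of_forall hpt)).trans (luxNorm_const_mul_le hp hct _)
    _ = 4 * (((volume Q) ^ 2)⁻¹ * luxNorm (sumExp p₁ p₂) (Q.indicator fun x => w₁ x * w₂ x)
        * N₁ * N₂) * weightedNorm p₁ w₁ f₁ * weightedNorm p₂ w₂ f₂ := by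
        rw [hc, ENNReal.inv_pow]
        ring
    _ ≤ 4 * K * weightedNorm p₁ w₁ f₁ * weightedNorm p₂ w₂ f₂ := by gcongr
    _ = _ := by push_cast; rfl

/-- A function in the unit ball of `L^{p(·)}(w)` whose averages are those of `h / w`. -/
theorem exists_memWeighted {n : ℕ} {p w h : Rn n → ℝ≥0∞} (hw : IsWeight w)
    (hh : AEMeasurable h volume) (hht : ∀ x, h x ≠ ∞) (hp1 : modular p h ≤ 1) :
    ∃ f : Rn n → ℂ, MemWeighted p w f ∧ weightedNorm p w f ≤ 1 ∧
      ∀ Q, IsCube Q → IntegrableOn f Q →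
        ‖⨍ x in Q, f x‖ₑ = (volume Q)⁻¹ * ∫⁻ x in Q, h x * (w x)⁻¹ := by
  have hm : AEMeasurable (fun x => h x * (w x)⁻¹) volume := hh.mul hw.aemeasurable.inv
  have hfin : ∀ᵐ x, h x * (w x)⁻¹ < ∞ := by
    filter_upwards [hw.pos] with x hx
    exact ENNReal.mul_lt_top (hht x).lt_top (ENNReal.inv_lt_top.2 hx)
  have henorm : ∀ᵐ x, ‖(((h x * (w x)⁻¹).toReal : ℝ) : ℂ)‖ₑ = h x * (w x)⁻¹ := by
    filter_upwards [hfin] with x hx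
    rw [← ofReal_norm, Complex.norm_real, Real.norm_of_nonneg ENNReal.toReal_nonneg,
      ENNReal.ofReal_toReal hx.ne]
  have hmod : modular p (fun x => ‖(((h x * (w x)⁻¹).toReal : ℝ) : ℂ)‖ₑ * w x / ((1 : ℝ≥0) : ℝ≥0∞))
      ≤ 1 := by
    refine (modular_mono_ae ?_).trans hp1
    filter_upwards [henorm, hw.pos, hw.lt_top] with x hx h0 ht
    rw [hx, mul_assoc, ENNReal.inv_mul_cancel h0.ne' ht.ne]
    simp
  refine ⟨fun x => (((h x * (w x)⁻¹).toReal : ℝ) : ℂ), ⟨?_, 1, one_pos, hmod.trans_lt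
    ENNReal.one_lt_top⟩, luxNorm_le one_pos hmod, fun Q hQ hint => ?_⟩
  · exact (Complex.measurable_ofReal.comp_aemeasurable hm.ennreal_toReal).aestronglyMeasurable
  · have e : ∫ x in Q, (((h x * (w x)⁻¹).toReal : ℝ) : ℂ) =
        (((∫⁻ x in Q, h x * (w x)⁻¹).toReal : ℝ) : ℂ) := by
      rw [integral_complex_ofReal, integral_toReal hm.restrict (ae_restrict_of_ae hfin)]
    have e2 : ∫⁻ x in Q, h x * (w x)⁻¹ ≠ ∞ := by
      have := hint.2
      rw [HasFiniteIntegral, lintegral_congr_ae (ae_restrict_of_ae henorm)] at this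
      exact this.ne
    rw [setAverage_eq, e, enorm_smul, hQ.enorm_volume_real_inv, ← ofReal_norm (E := ℂ),
      Complex.norm_real, Real.norm_of_nonneg ENNReal.toReal_nonneg, ENNReal.ofReal_toReal e2]

theorem bilinearAp_of_avgBounded {n : ℕ} {p₁ p₂ w₁ w₂ : Rn n → ℝ≥0∞}
    (hp₁ : IsExponent p₁) (hp₂ : IsExponent p₂) (hw₁ : IsWeight w₁) (hw₂ : IsWeight w₂)
    (h : AvgBounded p₁ p₂ w₁ w₂) : BilinearAp p₁ p₂ w₁ w₂ := by
  obtain ⟨C, hC⟩ := h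
  have hp := hp₁.sumExp_isQuasiExponent hp₂
  refine lt_of_le_of_lt (b := (9 * C : ℝ≥0∞)) (iSup₂_le fun Q hQ => ?_) (by finiteness)
  set N₀ := luxNorm (sumExp p₁ p₂) (Q.indicator fun x => w₁ x * w₂ x) with hN₀
  set D := ((volume Q) ^ 2)⁻¹ * N₀ with hD
  rcases eq_or_ne D 0 with hD0 | hD0
  · simp [hD0]
  -- Dividing by D isolates the product of the dual norms, which is bounded through finite a and b
  -- strictly below them; nothing is assumed finite here. The constant 9 is 3 · 3 from the two
  -- conjugate formulas.
  rw [mul_assoc, mul_comm, ← ENNReal.le_div_iff_mul_le (Or.inl hD0) (Or.inr (by finiteness))]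
  refine ENNReal.mul_le_of_forall_lt fun a ha b hb => ?_
  rw [ENNReal.le_div_iff_mul_le (Or.inl hD0) (Or.inr (by finiteness))]
  lift a to ℝ≥0 using ha.ne_top
  lift b to ℝ≥0 using hb.ne_top
  obtain ⟨h₁, hm₁, ht₁, hmod₁, ha⟩ := exists_le_lintegral_mul hp₁
    (hw₁.aemeasurable.inv.indicator hQ.measurableSet) ha
  obtain ⟨h₂, hm₂, ht₂, hmod₂, hb⟩ := exists_le_lintegral_mul hp₂
    (hw₂.aemeasurable.inv.indicator hQ.measurableSet) hb
  obtain ⟨f₁, hf₁, hn₁, he₁⟩ := exists_memWeighted hw₁ hm₁ ht₁ hmod₁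
  obtain ⟨f₂, hf₂, hn₂, he₂⟩ := exists_memWeighted hw₂ hm₂ ht₂ hmod₂
  obtain ⟨hi₁, hi₂, hle⟩ := hC f₁ f₂ hf₁ hf₂ Q hQ
  have ind : ∀ (h w : Rn n → ℝ≥0∞), ∫⁻ x, h x * Q.indicator (fun x => (w x)⁻¹) x =
      ∫⁻ x in Q, h x * (w x)⁻¹ := fun h w => by
    rw [← lintegral_indicator hQ.measurableSet]
    refine lintegral_congr fun x => ?_
    by_cases hx : x ∈ Q <;> simp [hx]
  have key : ‖⨍ x in Q, f₁ x‖ₑ * ‖⨍ x in Q, f₂ x‖ₑ * N₀ ≤ C := by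
    refine (const_mul_luxNorm_le hp (by finiteness) _).trans (le_trans ?_ (hle.trans ?_))
    · refine luxNorm_mono_ae (Filter.Eventually.of_forall fun x => ?_)
      by_cases hx : x ∈ Q <;> simp [avgOp, hx]
    · calc _ ≤ (C : ℝ≥0∞) * 1 * 1 := by gcongr
        _ = C := by simp
  have ha' : (a : ℝ≥0∞) ≤ 3 * ∫⁻ x in Q, h₁ x * (w₁ x)⁻¹ := by rw [← ind]; exact ha
  have hb' : (b : ℝ≥0∞) ≤ 3 * ∫⁻ x in Q, h₂ x * (w₂ x)⁻¹ := by rw [← ind]; exact hb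
  calc (a : ℝ≥0∞) * b * D
      ≤ (3 * ∫⁻ x in Q, h₁ x * (w₁ x)⁻¹) * (3 * ∫⁻ x in Q, h₂ x * (w₂ x)⁻¹) * D := by
        gcongr
    _ = 9 * (((volume Q)⁻¹ * ∫⁻ x in Q, h₁ x * (w₁ x)⁻¹) *
        ((volume Q)⁻¹ * ∫⁻ x in Q, h₂ x * (w₂ x)⁻¹) * N₀) := by
        rw [hD, ENNReal.inv_pow]
        ring
    _ ≤ 9 * C := by rw [← he₁ Q hQ hi₁, ← he₂ Q hQ hi₂]; gcongr

theorem avgBounded_of_famBounded {n : ℕ} {p₁ p₂ w₁ w₂ : Rn n → ℝ≥0∞}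
    (h : FamBounded p₁ p₂ w₁ w₂) : AvgBounded p₁ p₂ w₁ w₂ := by
  obtain ⟨C, hC⟩ := h
  refine ⟨C, fun f₁ f₂ hf₁ hf₂ Q hQ => ?_⟩
  obtain ⟨h1, h2⟩ := hC f₁ f₂ hf₁ hf₂ {Q} (by simpa using hQ) (Set.pairwiseDisjoint_singleton _ _)
  refine ⟨(h1 Q rfl).1, (h1 Q rfl).2, ?_⟩
  have : famOp {Q} f₁ f₂ = avgOp Q f₁ f₂ := by
    funext x
    rw [famOp, tsum_eq_single (⟨Q, rfl⟩ : ({Q} : Set (Set (Rn n))))]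
    · by_cases hx : x ∈ Q <;> simp [avgOp, hx]
    · exact fun Q' hne => absurd (Subsingleton.elim _ _) hne
  rwa [this] at h2

/-! ### Log-Hölder exponents and the mass of a cube -/

/-- An integrable, polynomially decaying density on `ℝⁿ`. -/
def decay {n : ℕ} (z : Rn n) : ℝ≥0∞ := ENNReal.ofReal ((1 + ‖z‖) ^ (-((n : ℝ) + 1)))

theorem lintegral_decay_lt_top (n : ℕ) : ∫⁻ z : Rn n, decay z < ∞ :=
  finite_integral_one_add_norm (by simp)

theorem norm_le_of_forall_abs_le {n : ℕ} {v : Rn n} {r : ℝ} (hr : 0 ≤ r)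
    (hv : ∀ i, |v i| ≤ r) : ‖v‖ ≤ n * r := by
  refine abs_le_of_sq_le_sq' ?_ (by positivity) |>.2
  rw [EuclideanSpace.real_norm_sq_eq]
  calc ∑ i, v i ^ 2 ≤ ∑ _i : Fin n, r ^ 2 :=
        Finset.sum_le_sum fun i _ => sq_le_sq' (by linarith [neg_abs_le (v i), hv i])
          ((le_abs_self _).trans (hv i))
    _ = n * r ^ 2 := by simp
    _ ≤ (n * n) * r ^ 2 := by
        gcongr
        exact_mod_cast Nat.le_mul_self n
    _ = _ := by ring

/-- Lower bound for the mass of a cube: it contains a cube of side at most `1` around each of its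
points. -/
theorem le_setLIntegral_decay {n : ℕ} {a : Rn n} {l : ℝ} (hl : 0 < l) {x : Rn n}
    (hx : ∀ i, a i ≤ x i ∧ x i < a i + l) :
    ENNReal.ofReal ((min l 1) ^ n * (1 + ‖x‖ + n) ^ (-((n : ℝ) + 1))) ≤
      ∫⁻ z in {z : Rn n | ∀ i, a i ≤ z i ∧ z i < a i + l}, decay z := by
  set r := min l 1 with hr
  have hr0 : 0 < r := lt_min hl one_pos
  have hrl : r ≤ l := min_le_left _ _
  have hr1 : r ≤ 1 := min_le_right _ _
  set b : Rn n := WithLp.toLp 2 fun i => min (x i) (a i + l - r) with hb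
  have hbi : ∀ i, b i = min (x i) (a i + l - r) := fun i => rfl
  have hsub : {z : Rn n | ∀ i, b i ≤ z i ∧ z i < b i + r} ⊆
      {z : Rn n | ∀ i, a i ≤ z i ∧ z i < a i + l} := by
    intro z hz i
    obtain ⟨h1, h2⟩ := hz i
    rw [hbi] at h1 h2
    refine ⟨(le_min (hx i).1 (by linarith)).trans h1, ?_⟩
    linarith [min_le_right (x i) (a i + l - r)]
  have hnorm : ∀ z ∈ {z : Rn n | ∀ i, b i ≤ z i ∧ z i < b i + r}, ‖z‖ ≤ ‖x‖ + n := by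
    intro z hz
    have : ‖z - x‖ ≤ n * r := by
      refine norm_le_of_forall_abs_le hr0.le fun i => ?_
      obtain ⟨h1, h2⟩ := hz i
      rw [hbi] at h1 h2
      have h3 : x i ≤ min (x i) (a i + l - r) + r := by
        rcases min_choice (x i) (a i + l - r) with h | h <;> rw [h] <;> linarith [(hx i).2]
      rw [PiLp.sub_apply, abs_le]
      constructor <;> linarith [min_le_left (x i) (a i + l - r)]
    have h4 : (n : ℝ) * r ≤ n * 1 := by gcongr
    have h5 := norm_add_le x (z - x)
    rw [add_sub_cancel] at h5
    linarith
  calc ENNReal.ofReal (r ^ n * (1 + ‖x‖ + n) ^ (-((n : ℝ) + 1)))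
      = ENNReal.ofReal ((1 + ‖x‖ + n) ^ (-((n : ℝ) + 1))) *
          volume {z : Rn n | ∀ i, b i ≤ z i ∧ z i < b i + r} := by
        rw [volume_cube, ENNReal.ofReal_mul (by positivity), ENNReal.ofReal_pow hr0.le, mul_comm]
    _ = ∫⁻ _z in {z : Rn n | ∀ i, b i ≤ z i ∧ z i < b i + r},
          ENNReal.ofReal ((1 + ‖x‖ + n) ^ (-((n : ℝ) + 1))) := by rw [setLIntegral_const]
    _ ≤ ∫⁻ z in {z : Rn n | ∀ i, b i ≤ z i ∧ z i < b i + r}, decay z := by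
        refine setLIntegral_mono' (measurableSet_cube b r) fun z hz => ?_
        refine ENNReal.ofReal_le_ofReal (Real.rpow_le_rpow_of_nonpos (by positivity) ?_ ?_)
        · linarith [hnorm z hz]
        · linarith [(n.cast_nonneg : (0 : ℝ) ≤ n)]
    _ ≤ _ := lintegral_mono_set hsub

theorem IsExponent.inv_ne_top {n : ℕ} {p : Rn n → ℝ≥0∞} (hp : IsExponent p) (x : Rn n) :
    (p x)⁻¹ ≠ ∞ :=
  ENNReal.inv_ne_top.2 (zero_lt_one.trans_le (hp.one_le x)).ne'

theorem IsExponent.toReal_inv_le_one {n : ℕ} {p : Rn n → ℝ≥0∞} (hp : IsExponent p) (x : Rn n) :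
    ((p x)⁻¹).toReal ≤ 1 := by
  simpa using ENNReal.toReal_mono ENNReal.one_ne_top (ENNReal.inv_le_one.2 (hp.one_le x))

theorem IsExponent.abs_sub_le_one {n : ℕ} {p : Rn n → ℝ≥0∞} (hp : IsExponent p) (x y : Rn n) :
    |((p x)⁻¹).toReal - ((p y)⁻¹).toReal| ≤ 1 := by
  rw [abs_le]
  constructor <;> linarith [hp.toReal_inv_le_one x, hp.toReal_inv_le_one y,
    (ENNReal.toReal_nonneg : 0 ≤ ((p x)⁻¹).toReal), (ENNReal.toReal_nonneg : 0 ≤ ((p y)⁻¹).toReal)]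

/-- Local log-Hölder continuity controls the oscillation of `1 / p` on a cube against the
logarithm of its side length. -/
theorem LocLogHolder.osc_mul_log_le {n : ℕ} {p : Rn n → ℝ≥0∞} (hp : IsExponent p)
    (h : LocLogHolder p) : ∃ L : ℝ, ∀ (l : ℝ) (x y : Rn n), 0 < l → ‖x - y‖ ≤ n * l →
      |((p x)⁻¹).toReal - ((p y)⁻¹).toReal| * (-Real.log (min l 1)) ≤ L := by
  obtain ⟨C₀, hC₀⟩ := h
  -- For l ≥ 1 the logarithm vanishes. For 1/(2(n+1)) ≤ l < 1 it is at most log(2(n+1)), and the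
  -- oscillation is at most 1. For smaller l the points are closer than 1/2 and the hypothesis
  -- applies.
  refine ⟨|C₀| + Real.log (2 * (n + 1)), fun l x y hl hxy => ?_⟩
  have hn0 : (0 : ℝ) ≤ n := n.cast_nonneg
  have hlog2 : 0 ≤ Real.log (2 * ((n : ℝ) + 1)) := Real.log_nonneg (by linarith)
  have hlog1 : 0 ≤ Real.log ((n : ℝ) + 1) := Real.log_nonneg (by linarith)
  have hlog12 : Real.log ((n : ℝ) + 1) ≤ Real.log (2 * ((n : ℝ) + 1)) :=
    Real.log_le_log (by linarith) (by linarith)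
  have hδ1 := hp.abs_sub_le_one x y
  have hδ := abs_nonneg (((p x)⁻¹).toReal - ((p y)⁻¹).toReal)
  rcases le_or_gt 1 l with h1 | h1
  · rw [min_eq_right h1]
    simp only [Real.log_one, neg_zero, mul_zero]
    positivity
  rw [min_eq_left h1.le]
  rcases le_or_gt (1 / 2) ((n + 1) * l) with h2 | h2
  · have h3 : -Real.log l ≤ Real.log (2 * (n + 1)) := by
      rw [← Real.log_inv]
      refine Real.log_le_log (by positivity) ?_
      rw [inv_le_iff_one_le_mul₀ hl]
      linarith
    have h5 : -Real.log l ≥ 0 := by linarith [Real.log_nonpos hl.le h1.le]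
    calc _ ≤ 1 * (-Real.log l) := by gcongr
      _ ≤ _ := by linarith [abs_nonneg C₀]
  · have hnl : 0 < ((n : ℝ) + 1) * l := by positivity
    have h4 : -Real.log l = -Real.log ((n + 1) * l) + Real.log (n + 1) := by
      rw [Real.log_mul (by positivity) hl.ne']
      ring
    have h6 : 0 < -Real.log ((n + 1) * l) := by
      linarith [Real.log_neg hnl (by linarith)]
    have h5 : |((p x)⁻¹).toReal - ((p y)⁻¹).toReal| * (-Real.log ((n + 1) * l)) ≤ |C₀| := by
      rcases eq_or_ne x y with rfl | hne
      · simp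
      have h7 : 0 < ‖x - y‖ := norm_pos_iff.2 (sub_ne_zero.2 hne)
      have h8 : ‖x - y‖ ≤ (n + 1) * l := by linarith
      have h9 : -Real.log ((n + 1) * l) ≤ -Real.log ‖x - y‖ := by
        linarith [Real.log_le_log h7 h8]
      have h10 := hC₀ x y (by linarith)
      rw [le_div_iff₀ (by linarith)] at h10
      calc _ ≤ _ := mul_le_mul_of_nonneg_left h9 hδ
        _ ≤ _ := h10.trans (le_abs_self _)
    rw [h4, mul_add]
    refine add_le_add h5 (le_trans ?_ hlog12)
    exact mul_le_of_le_one_left hlog1 hδ1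

/-- Log-Hölder continuity at infinity controls the oscillation of `1 / p` against the logarithm of
the distance to the origin. -/
theorem LogHolderAtInfty.osc_mul_log_le {n : ℕ} {p : Rn n → ℝ≥0∞} (hp : IsExponent p)
    (h : LogHolderAtInfty p) : ∃ L : ℝ, ∀ x y : Rn n, ‖x‖ ≤ ‖y‖ →
      |((p x)⁻¹).toReal - ((p y)⁻¹).toReal| * Real.log (1 + ‖x‖ + n) ≤ L := by
  obtain ⟨C, pinf, -, -, hC⟩ := h
  refine ⟨Real.log (n + 1) + 2 * |C|, fun x y hxy => ?_⟩
  have hn0 : (0 : ℝ) ≤ n := n.cast_nonneg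
  have he : 1 < Real.exp 1 := by simp
  have hlog1 : 0 ≤ Real.log ((n : ℝ) + 1) := Real.log_nonneg (by linarith)
  have hδ1 := hp.abs_sub_le_one x y
  have hδ := abs_nonneg (((p x)⁻¹).toReal - ((p y)⁻¹).toReal)
  have hx0 := norm_nonneg x
  have hE : 0 < Real.log (Real.exp 1 + ‖x‖) := Real.log_pos (by linarith)
  have h1 : Real.log (1 + ‖x‖ + n) ≤ Real.log (n + 1) + Real.log (Real.exp 1 + ‖x‖) := by
    rw [← Real.log_mul (by positivity) (by positivity)]
    exact Real.log_le_log (by positivity) (by nlinarith)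
  have hdiv : ∀ z : Rn n, ‖x‖ ≤ ‖z‖ → |((p z)⁻¹).toReal - (pinf⁻¹).toReal| ≤
      |C| / Real.log (Real.exp 1 + ‖x‖) := fun z hz => by
    refine (hC z).trans ?_
    gcongr
    exact le_abs_self C
  -- Both points lie at distance at least ‖x‖ from the origin, so both values are compared with the
  -- limit at the rate for ‖x‖.
  have h2 : |((p x)⁻¹).toReal - ((p y)⁻¹).toReal| ≤
      2 * (|C| / Real.log (Real.exp 1 + ‖x‖)) := by
    have := abs_sub_le ((p x)⁻¹).toReal (pinf⁻¹).toReal ((p y)⁻¹).toReal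
    rw [abs_sub_comm (pinf⁻¹).toReal] at this
    linarith [hdiv x le_rfl, hdiv y hxy]
  calc _ ≤ |((p x)⁻¹).toReal - ((p y)⁻¹).toReal| *
        (Real.log (n + 1) + Real.log (Real.exp 1 + ‖x‖)) := by gcongr
    _ = |((p x)⁻¹).toReal - ((p y)⁻¹).toReal| * Real.log (n + 1) +
        |((p x)⁻¹).toReal - ((p y)⁻¹).toReal| * Real.log (Real.exp 1 + ‖x‖) := mul_add _ _ _
    _ ≤ Real.log (n + 1) + 2 * (|C| / Real.log (Real.exp 1 + ‖x‖)) *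
        Real.log (Real.exp 1 + ‖x‖) := by
        gcongr
        exact mul_le_of_le_one_left hlog1 hδ1
    _ = _ := by rw [mul_assoc, div_mul_cancel₀ _ hE.ne']

/-- For a log-Hölder exponent, the mass of a cube raised to the oscillation of `1 / p` is bounded
below uniformly over all cubes. -/
theorem LogHolder.one_le_mul_mass_rpow {n : ℕ} {p : Rn n → ℝ≥0∞} (hp : IsExponent p)
    (h : LogHolder p) : ∃ M : ℝ≥0, ∀ Q : Set (Rn n), IsCube Q → ∀ x ∈ Q, ∀ y ∈ Q,
      1 ≤ M * (∫⁻ z in Q, decay z) ^ |((p x)⁻¹).toReal - ((p y)⁻¹).toReal| := by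
  obtain ⟨L₁, hL₁⟩ := h.1.osc_mul_log_le hp
  obtain ⟨L₂, hL₂⟩ := h.2.osc_mul_log_le hp
  refine ⟨Real.toNNReal (Real.exp (n * L₁ + (n + 1) * L₂)), ?_⟩
  suffices H : ∀ Q : Set (Rn n), IsCube Q → ∀ x ∈ Q, ∀ y ∈ Q, ‖x‖ ≤ ‖y‖ →
      1 ≤ ENNReal.ofReal (Real.exp (n * L₁ + (n + 1) * L₂)) *
        (∫⁻ z in Q, decay z) ^ |((p x)⁻¹).toReal - ((p y)⁻¹).toReal| by
    intro Q hQ x hx y hy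
    rcases le_total ‖x‖ ‖y‖ with hxy | hxy
    · exact H Q hQ x hx y hy hxy
    · rw [abs_sub_comm]
      exact H Q hQ y hy x hx hxy
  rintro Q ⟨a, l, hl, rfl⟩ x hx y hy hxy
  have hxyl : ‖x - y‖ ≤ n * l := by
    refine norm_le_of_forall_abs_le hl.le fun i => ?_
    rw [PiLp.sub_apply, abs_le]
    constructor <;> linarith [(hx i).1, (hx i).2, (hy i).1, (hy i).2]
  have h1 := hL₁ l x y hl hxyl
  have h2 := hL₂ x y hxy
  have hm := le_setLIntegral_decay hl hx
  set δ := |((p x)⁻¹).toReal - ((p y)⁻¹).toReal|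
  have hδ : 0 ≤ δ := abs_nonneg _
  have hr0 : 0 < min l 1 := lt_min hl one_pos
  have hR : 0 < 1 + ‖x‖ + n := by positivity
  set m := (min l 1) ^ n * (1 + ‖x‖ + n) ^ (-((n : ℝ) + 1)) with hmdef
  have hm0 : 0 < m := by positivity
  have hlog : Real.log m = n * Real.log (min l 1) - (n + 1) * Real.log (1 + ‖x‖ + n) := by
    rw [hmdef, Real.log_mul (by positivity) (by positivity), Real.log_pow, Real.log_rpow hR]
    ring
  -- The lower bound m for the mass has logarithm n log(min l 1) − (n+1) log(1+‖x‖+n). The local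
  -- condition controls the first term times δ, the condition at infinity the second.
  have h3 : 0 ≤ n * L₁ + (n + 1) * L₂ + Real.log m * δ := by
    rw [hlog]
    have k1 := mul_le_mul_of_nonneg_left h1 (n.cast_nonneg : (0 : ℝ) ≤ n)
    have k2 := mul_le_mul_of_nonneg_left h2 (by positivity : (0 : ℝ) ≤ n + 1)
    linarith
  calc (1 : ℝ≥0∞) ≤ ENNReal.ofReal (Real.exp (n * L₁ + (n + 1) * L₂ + Real.log m * δ)) := by
        rw [ENNReal.one_le_ofReal]
        exact Real.one_le_exp h3
    _ = ENNReal.ofReal (Real.exp (n * L₁ + (n + 1) * L₂)) * ENNReal.ofReal m ^ δ := by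
        rw [Real.exp_add, ENNReal.ofReal_mul (Real.exp_pos _).le, ← Real.rpow_def_of_pos hm0,
          ENNReal.ofReal_rpow_of_pos hm0]
    _ ≤ _ := by gcongr

/-- For a log-Hölder exponent, powers `t ^ (1 / p)` are essentially constant on a cube, as long as
`t` is bounded and not smaller than the mass of the cube. -/
theorem LogHolder.rpow_le_mul_rpow {n : ℕ} {p : Rn n → ℝ≥0∞} (hp : IsExponent p)
    (h : LogHolder p) {T : ℝ≥0} (hT : 1 ≤ T) : ∃ K : ℝ≥0, 0 < K ∧ ∀ Q : Set (Rn n), IsCube Q →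
      ∀ x ∈ Q, ∀ y ∈ Q, ∀ t : ℝ≥0∞, ∫⁻ z in Q, decay z ≤ t → t ≤ T →
        t ^ ((p y)⁻¹).toReal ≤ K * t ^ ((p x)⁻¹).toReal := by
  obtain ⟨M, hM⟩ := h.one_le_mul_mass_rpow hp
  refine ⟨M + T, add_pos_of_nonneg_of_pos (zero_le) (zero_lt_one.trans_le hT),
    fun Q hQ x hx y hy t ht htT => ?_⟩
  have hsx : 0 ≤ ((p x)⁻¹).toReal := ENNReal.toReal_nonneg
  have hsy : 0 ≤ ((p y)⁻¹).toReal := ENNReal.toReal_nonneg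
  -- If the exponent at y is larger, the surplus power of t is at most T because t ≤ T and T ≥ 1.
  -- Otherwise the missing power is at least that of the mass, and M compensates.
  rcases le_total ((p x)⁻¹).toReal ((p y)⁻¹).toReal with hle | hle
  · have hT' : (1 : ℝ≥0∞) ≤ T := by exact_mod_cast hT
    have h1 : t ^ (((p y)⁻¹).toReal - ((p x)⁻¹).toReal) ≤ T := by
      calc _ ≤ (T : ℝ≥0∞) ^ (((p y)⁻¹).toReal - ((p x)⁻¹).toReal) := by
            refine ENNReal.rpow_le_rpow htT (sub_nonneg.2 hle)
        _ ≤ (T : ℝ≥0∞) ^ (1 : ℝ) := by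
            refine ENNReal.rpow_le_rpow_of_exponent_le hT' ?_
            linarith [hp.toReal_inv_le_one y]
        _ = T := ENNReal.rpow_one _
    calc t ^ ((p y)⁻¹).toReal
        = t ^ (((p y)⁻¹).toReal - ((p x)⁻¹).toReal) * t ^ ((p x)⁻¹).toReal := by
          rw [← ENNReal.rpow_add_of_nonneg _ _ (sub_nonneg.2 hle) hsx, sub_add_cancel]
      _ ≤ T * t ^ ((p x)⁻¹).toReal := by gcongr
      _ ≤ _ := by
          gcongr
          exact_mod_cast le_add_self
  · have h1 := hM Q hQ x hx y hy
    rw [abs_of_nonneg (sub_nonneg.2 hle)] at h1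
    calc t ^ ((p y)⁻¹).toReal = 1 * t ^ ((p y)⁻¹).toReal := (one_mul _).symm
      _ ≤ (M * t ^ (((p x)⁻¹).toReal - ((p y)⁻¹).toReal)) * t ^ ((p y)⁻¹).toReal := by
          gcongr
          refine h1.trans ?_
          gcongr
      _ = M * t ^ ((p x)⁻¹).toReal := by
          rw [mul_assoc, ← ENNReal.rpow_add_of_nonneg _ _ (sub_nonneg.2 hle) hsy, sub_add_cancel]
      _ ≤ _ := by
          gcongr
          exact_mod_cast le_self_add

/-! ### Energies of cubes -/

/-- The part of the modular of `u` that lives on the cube `Q` and on `{p < ∞}`, plus the mass of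
the cube. -/
def cubeEnergy {n : ℕ} (p u : Rn n → ℝ≥0∞) (Q : Set (Rn n)) : ℝ≥0∞ :=
  (∫⁻ y in Q, u y ^ (p y).toReal ∂(volume.restrict {x | p x ≠ ∞})) + ∫⁻ z in Q, decay z

theorem cubeEnergy_le {n : ℕ} {p u : Rn n → ℝ≥0∞} (hu : modular p u ≤ 1) (Q : Set (Rn n)) :
    cubeEnergy p u Q ≤ 1 + ∫⁻ z : Rn n, decay z :=
  add_le_add ((setLIntegral_le_lintegral _ _).trans (le_self_add.trans hu))
    (setLIntegral_le_lintegral _ _)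

/-- Each cube has positive measure and Lebesgue measure is σ-finite. Countability allows summing
integrals and merging null sets over the family. -/
theorem countable_of_cubes {n : ℕ} {𝒬 : Set (Set (Rn n))} (h𝒬 : ∀ Q ∈ 𝒬, IsCube Q)
    (hd : 𝒬.PairwiseDisjoint id) : 𝒬.Countable := by
  have h := Measure.countable_meas_pos_of_disjoint_iUnion (μ := (volume : Measure (Rn n)))
    (As := fun Q : 𝒬 => (Q : Set (Rn n))) (fun Q => (h𝒬 Q Q.2).measurableSet)
    (fun Q R hQR => hd Q.2 R.2 (fun h => hQR (Subtype.ext h)))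
  have h' : {Q : 𝒬 | 0 < volume (Q : Set (Rn n))} = Set.univ :=
    Set.eq_univ_of_forall fun Q => pos_iff_ne_zero.2 (h𝒬 Q Q.2).volume_ne_zero
  rw [h', Set.countable_univ_iff] at h
  exact h

theorem tsum_cubeEnergy_le {n : ℕ} {p u : Rn n → ℝ≥0∞} (hu : modular p u ≤ 1)
    {𝒬 : Set (Set (Rn n))} (h𝒬 : ∀ Q ∈ 𝒬, IsCube Q) (hd : 𝒬.PairwiseDisjoint id) :
    ∑' Q : 𝒬, cubeEnergy p u Q ≤ 1 + ∫⁻ z : Rn n, decay z := by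
  have hc := countable_of_cubes h𝒬 hd
  have hm : ∀ Q ∈ 𝒬, MeasurableSet (id Q) := fun Q hQ => (h𝒬 Q hQ).measurableSet
  have e1 := lintegral_biUnion (μ := volume.restrict {x | p x ≠ ∞}) hc hm hd
    (fun y => u y ^ (p y).toReal)
  have e2 := lintegral_biUnion (μ := volume) hc hm hd (fun z : Rn n => decay z)
  simp only [id] at e1 e2
  simp only [cubeEnergy]
  rw [ENNReal.tsum_add, ← e1, ← e2]
  exact add_le_add ((setLIntegral_le_lintegral _ _).trans (le_self_add.trans hu))
    (setLIntegral_le_lintegral _ _)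

theorem cubeEnergy_ne_zero {n : ℕ} (p u : Rn n → ℝ≥0∞) {Q : Set (Rn n)} (hQ : IsCube Q) :
    cubeEnergy p u Q ≠ 0 := by
  intro h
  obtain ⟨a, l, hl, rfl⟩ := hQ
  have hx : ∀ i, a i ≤ a i ∧ a i < a i + l := fun i => ⟨le_rfl, by linarith⟩
  have h1 := (le_setLIntegral_decay hl hx).trans (le_add_self.trans h.le)
  rw [nonpos_iff_eq_zero, ENNReal.ofReal_eq_zero] at h1
  have : 0 < min l 1 := lt_min hl one_pos
  exact absurd h1 (not_le.2 (by positivity))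

/-- The norm of `u` on a cube is controlled by its energy there, raised to the value of `1 / p` at
any point of the cube. -/
theorem luxNorm_indicator_le_cubeEnergy {n : ℕ} {p u : Rn n → ℝ≥0∞} (hp : IsExponent p)
    (hu : modular p u ≤ 1) {Q : Set (Rn n)} (hQ : IsCube Q) {K : ℝ≥0} (hK0 : 0 < K) {x : Rn n}
    (hK : ∀ y ∈ Q, cubeEnergy p u Q ^ ((p y)⁻¹).toReal ≤
      K * cubeEnergy p u Q ^ ((p x)⁻¹).toReal)
    (ht : cubeEnergy p u Q ≠ ∞) :
    luxNorm p (Q.indicator u) ≤ 2 * K * cubeEnergy p u Q ^ ((p x)⁻¹).toReal := by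
  set t := cubeEnergy p u Q with htdef
  have ht0 : t ≠ 0 := cubeEnergy_ne_zero p u hQ
  have hl0 : 2 * K * t ^ ((p x)⁻¹).toReal ≠ 0 :=
    mul_ne_zero (mul_ne_zero two_ne_zero (by simpa using hK0.ne'))
      (ENNReal.rpow_pos (pos_iff_ne_zero.2 ht0) ht).ne'
  have hlt : 2 * K * t ^ ((p x)⁻¹).toReal ≠ ∞ :=
    ENNReal.mul_ne_top (by finiteness) (ENNReal.rpow_ne_top_of_nonneg ENNReal.toReal_nonneg ht)
  rw [← ENNReal.coe_toNNReal hlt]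
  refine luxNorm_le (pos_iff_ne_zero.2 fun h => ?_) ?_
  · rw [ENNReal.toNNReal_eq_zero_iff] at h
    exact h.elim hl0 hlt
  rw [ENNReal.coe_toNNReal hlt]
  -- Replacing the exponent at x by that at y makes the p(y)-th power produce exactly t⁻¹. The
  -- factor 2 leaves 1/2 each for the integral and the supremum part; where p(y) = ∞, the power of t
  -- is 1.
  have hpt : ∀ y ∈ Q, u y / (2 * K * t ^ ((p x)⁻¹).toReal) ≤
      2⁻¹ * ((t ^ ((p y)⁻¹).toReal)⁻¹ * u y) := fun y hy => by
    calc u y / (2 * K * t ^ ((p x)⁻¹).toReal) ≤ u y / (2 * t ^ ((p y)⁻¹).toReal) := by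
          refine ENNReal.div_le_div_left ?_ _
          rw [mul_assoc]
          gcongr
          exact hK y hy
      _ = _ := by
          rw [div_eq_mul_inv, ENNReal.mul_inv (by simp) (by simp)]
          ring
  have b1 : ∫⁻ y in {y | p y ≠ ∞},
      (Q.indicator u y / (2 * K * t ^ ((p x)⁻¹).toReal)) ^ (p y).toReal ≤ 2⁻¹ := by
    calc _ ≤ ∫⁻ y in {y | p y ≠ ∞}, Q.indicator (fun y => 2⁻¹ * t⁻¹ * u y ^ (p y).toReal) y := by
          refine lintegral_mono_ae ?_
          filter_upwards [ae_restrict_mem₀ (nullMeasurableSet_ne_top hp.aemeasurable)] with y hy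
          have hp1 : 1 ≤ (p y).toReal := by
            simpa using ENNReal.toReal_mono hy (hp.one_le y)
          by_cases hyQ : y ∈ Q
          · rw [Set.indicator_of_mem hyQ, Set.indicator_of_mem hyQ]
            refine (ENNReal.rpow_le_rpow (hpt y hyQ) ENNReal.toReal_nonneg).trans ?_
            rw [ENNReal.mul_rpow_of_nonneg _ _ ENNReal.toReal_nonneg,
              ENNReal.mul_rpow_of_nonneg _ _ ENNReal.toReal_nonneg, ENNReal.inv_rpow (t ^ _),
              ← ENNReal.rpow_mul, ENNReal.toReal_inv, inv_mul_cancel₀ (by linarith),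
              ENNReal.rpow_one, ← mul_assoc]
            gcongr ?_ * _ * _
            calc (2⁻¹ : ℝ≥0∞) ^ (p y).toReal ≤ 2⁻¹ ^ (1 : ℝ) :=
                  ENNReal.rpow_le_rpow_of_exponent_ge (by simp) hp1
              _ = 2⁻¹ := ENNReal.rpow_one _
          · simp [hyQ, show 0 < (p y).toReal by linarith]
      _ = 2⁻¹ * t⁻¹ * ∫⁻ y in Q, u y ^ (p y).toReal ∂(volume.restrict {x | p x ≠ ∞}) := by
          rw [lintegral_indicator hQ.measurableSet, lintegral_const_mul']
          exact ENNReal.mul_ne_top (by simp) (ENNReal.inv_ne_top.2 ht0)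
      _ ≤ 2⁻¹ * t⁻¹ * t := by
          gcongr
          exact le_self_add
      _ = 2⁻¹ := by rw [mul_assoc, ENNReal.inv_mul_cancel ht0 ht, mul_one]
  have b2 : essSup (fun y => Q.indicator u y / (2 * K * t ^ ((p x)⁻¹).toReal))
      (volume.restrict {y | p y = ∞}) ≤ 2⁻¹ := by
    refine essSup_le_of_ae_le _ ?_
    filter_upwards [ae_restrict_mem₀ (nullMeasurableSet_eq_top hp.aemeasurable),
      ae_restrict_of_ae (ae_le_one_of_modular_le_one hp.isQuasiExponent hu)] with y hy hy1
    by_cases hyQ : y ∈ Q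
    · rw [Set.indicator_of_mem hyQ]
      refine (hpt y hyQ).trans ?_
      simpa [show p y = ∞ from hy] using mul_le_mul_right (hy1 hy) (2⁻¹ : ℝ≥0∞)
    · simp [hyQ]
  exact (add_le_add b1 b2).trans_eq ENNReal.inv_two_add_inv_two

/-! ### Families of disjoint cubes -/

/-- Modular estimate for functions that are, on each cube of a disjoint family, controlled by a
normalized profile with summable coefficients. -/
theorem modular_le_of_forall_cube {n : ℕ} {p G : Rn n → ℝ≥0∞} (hp : IsQuasiExponent p)
    {𝒬 : Set (Set (Rn n))} (h𝒬 : ∀ Q ∈ 𝒬, IsCube Q) (hd : 𝒬.PairwiseDisjoint id)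
    {v : Set (Rn n) → Rn n → ℝ≥0∞} (hv : ∀ Q ∈ 𝒬, modular p (v Q) ≤ 1)
    {τ : Set (Rn n) → ℝ≥0∞} (hτ : ∀ Q ∈ 𝒬, τ Q ≠ ∞) {ε : ℝ≥0∞} (hε : ε ≤ 1)
    (hG : ∀ Q ∈ 𝒬, ∀ x ∈ Q, G x ≤ ε ^ 2 * τ Q ^ ((p x)⁻¹).toReal * v Q x)
    (hG0 : ∀ x, x ∉ ⋃ Q ∈ 𝒬, id Q → G x = 0) :
    modular p G ≤ ε * ∑' Q : 𝒬, τ Q + ε := by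
  have hc := countable_of_cubes h𝒬 hd
  have hm : ∀ Q ∈ 𝒬, MeasurableSet (id Q) := fun Q hQ => (h𝒬 Q hQ).measurableSet
  have hεt : ε ≠ ∞ := ne_top_of_le_ne_top ENNReal.one_ne_top hε
  refine add_le_add ?_ ?_
  · calc ∫⁻ x in {x | p x ≠ ∞}, G x ^ (p x).toReal
        ≤ ∫⁻ x in {x | p x ≠ ∞}, (⋃ Q ∈ 𝒬, id Q).indicator (fun x => G x ^ (p x).toReal) x := by
          refine lintegral_mono_ae ?_
          filter_upwards [ae_restrict_mem₀ (nullMeasurableSet_ne_top hp.aemeasurable)] with x hx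
          by_cases hxU : x ∈ ⋃ Q ∈ 𝒬, id Q
          · rw [Set.indicator_of_mem hxU]
          · have := hp.half_le_toReal hx
            simp [hG0 x hxU, show 0 < (p x).toReal by linarith]
      _ = ∑' Q : 𝒬, ∫⁻ x in id (Q : Set (Rn n)), G x ^ (p x).toReal
            ∂(volume.restrict {x | p x ≠ ∞}) := by
          rw [lintegral_indicator (MeasurableSet.biUnion hc hm), lintegral_biUnion hc hm hd]
      _ ≤ ∑' Q : 𝒬, ε * τ Q := by
          refine ENNReal.tsum_le_tsum fun Q => ?_
          calc ∫⁻ x in id (Q : Set (Rn n)), G x ^ (p x).toReal ∂(volume.restrict {x | p x ≠ ∞})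
              ≤ ∫⁻ x in id (Q : Set (Rn n)), ε * τ Q * v Q x ^ (p x).toReal
                  ∂(volume.restrict {x | p x ≠ ∞}) := by
                refine lintegral_mono_ae ?_
                filter_upwards [ae_restrict_of_ae
                  (ae_restrict_mem₀ (nullMeasurableSet_ne_top hp.aemeasurable)),
                  ae_restrict_mem (hm Q Q.2)] with x hx hxQ
                have hp1 := hp.half_le_toReal hx
                refine (ENNReal.rpow_le_rpow (hG Q Q.2 x hxQ) ENNReal.toReal_nonneg).trans ?_
                rw [ENNReal.mul_rpow_of_nonneg _ _ ENNReal.toReal_nonneg,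
                  ENNReal.mul_rpow_of_nonneg _ _ ENNReal.toReal_nonneg, ← ENNReal.rpow_mul,
                  ENNReal.toReal_inv, inv_mul_cancel₀ (by linarith), ENNReal.rpow_one]
                gcongr ?_ * _ * _
                -- The hypothesis carries ε² because 2p ≥ 1 gives ε^{2p} ≤ ε.
                rw [← ENNReal.rpow_natCast, ← ENNReal.rpow_mul]
                calc ε ^ (((2 : ℕ) : ℝ) * (p x).toReal) ≤ ε ^ (1 : ℝ) :=
                      ENNReal.rpow_le_rpow_of_exponent_ge hε (by push_cast; linarith)
                  _ = ε := ENNReal.rpow_one _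
            _ = ε * τ Q * ∫⁻ x in id (Q : Set (Rn n)), v Q x ^ (p x).toReal
                  ∂(volume.restrict {x | p x ≠ ∞}) :=
                lintegral_const_mul' _ _ (ENNReal.mul_ne_top hεt (hτ Q Q.2))
            _ ≤ ε * τ Q * 1 := by
                gcongr
                exact (setLIntegral_le_lintegral _ _).trans (le_self_add.trans (hv Q Q.2))
            _ = ε * τ Q := mul_one _
      _ = ε * ∑' Q : 𝒬, τ Q := ENNReal.tsum_mul_left
  · refine essSup_le_of_ae_le _ ?_
    have hall : ∀ᵐ x, ∀ Q ∈ 𝒬, p x = ∞ → v Q x ≤ 1 :=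
      (ae_ball_iff hc).2 fun Q hQ => ae_le_one_of_modular_le_one hp (hv Q hQ)
    filter_upwards [ae_restrict_mem₀ (nullMeasurableSet_eq_top hp.aemeasurable),
      ae_restrict_of_ae hall] with x hx hxv
    by_cases hxU : x ∈ ⋃ Q ∈ 𝒬, id Q
    · simp only [Set.mem_iUnion, id] at hxU
      obtain ⟨Q, hQ, hxQ⟩ := hxU
      calc G x ≤ _ := hG Q hQ x hxQ
        _ = ε ^ 2 * v Q x := by simp [show p x = ∞ from hx]
        _ ≤ ε ^ 2 * 1 := by
            gcongr
            exact hxv Q hQ hx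
        _ ≤ ε := by
            rw [mul_one, pow_two]
            exact mul_le_of_le_one_left (zero_le) hε
    · simp [hG0 x hxU]

theorem famOp_apply {n : ℕ} {𝒬 : Set (Set (Rn n))} (hd : 𝒬.PairwiseDisjoint id)
    {Q : Set (Rn n)} (hQ : Q ∈ 𝒬) {x : Rn n} (hx : x ∈ Q) (f₁ f₂ : Rn n → ℂ) :
    famOp 𝒬 f₁ f₂ x = (⨍ y in Q, f₁ y) * (⨍ y in Q, f₂ y) := by
  rw [famOp, tsum_eq_single (⟨Q, hQ⟩ : 𝒬)]
  · simp [avgOp, hx]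
  · rintro ⟨R, hR⟩ hne
    have hdis : Disjoint R Q := hd hR hQ fun h => hne (Subtype.ext h)
    exact Set.indicator_of_notMem (Set.disjoint_right.1 hdis hx) _

theorem famOp_apply_of_notMem {n : ℕ} {𝒬 : Set (Set (Rn n))} {x : Rn n}
    (hx : x ∉ ⋃ Q ∈ 𝒬, id Q) (f₁ f₂ : Rn n → ℂ) : famOp 𝒬 f₁ f₂ x = 0 := by
  simp only [Set.mem_iUnion, id, not_exists] at hx
  rw [famOp, ← tsum_zero (α := ℂ) (β := 𝒬)]
  exact tsum_congr fun Q => Set.indicator_of_notMem (hx Q Q.2) _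

/-- For functions in a ball of radius `l` of `L^{p(·)}(w)`, the averages over a cube are controlled
by the energy on the cube and the dual norm of the weight. -/
theorem enorm_setAverage_le_cubeEnergy {n : ℕ} {p w : Rn n → ℝ≥0∞} (hp : IsExponent p)
    (hw : IsWeight w) {K : ℝ≥0} (hK0 : 0 < K)
    (hK : ∀ Q : Set (Rn n), IsCube Q → ∀ x ∈ Q, ∀ y ∈ Q, ∀ t : ℝ≥0∞, ∫⁻ z in Q, decay z ≤ t →
      t ≤ 1 + ∫⁻ z : Rn n, decay z → t ^ ((p y)⁻¹).toReal ≤ K * t ^ ((p x)⁻¹).toReal)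
    {f : Rn n → ℂ} (hf : AEStronglyMeasurable f volume) {l : ℝ≥0} (hl : 0 < l)
    (hmod : modular p (fun x => ‖f x‖ₑ * w x / (l : ℝ≥0∞)) ≤ 1) {Q : Set (Rn n)} (hQ : IsCube Q)
    (hN : luxNorm (dualExp p) (Q.indicator fun x => (w x)⁻¹) ≠ ∞) {x : Rn n} (hx : x ∈ Q) :
    ‖⨍ y in Q, f y‖ₑ ≤ (volume Q)⁻¹ * (4 * K * l *
      cubeEnergy p (fun x => ‖f x‖ₑ * w x / (l : ℝ≥0∞)) Q ^ ((p x)⁻¹).toReal *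
      luxNorm (dualExp p) (Q.indicator fun x => (w x)⁻¹)) := by
  have hT := cubeEnergy_le hmod Q
  have htop : (1 + ∫⁻ z : Rn n, decay z) ≠ ∞ :=
    ENNReal.add_ne_top.2 ⟨ENNReal.one_ne_top, (lintegral_decay_lt_top n).ne⟩
  have hl0 : (l : ℝ≥0∞) ≠ 0 := by simpa using hl.ne'
  have h1 := luxNorm_indicator_le_cubeEnergy hp hmod hQ hK0 (x := x)
    (fun y hy => hK Q hQ x hx y hy _ le_add_self hT) (ne_top_of_le_ne_top htop hT)
  set t := cubeEnergy p (fun x => ‖f x‖ₑ * w x / (l : ℝ≥0∞)) Q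
  have htt : t ^ ((p x)⁻¹).toReal ≠ ∞ :=
    ENNReal.rpow_ne_top_of_nonneg ENNReal.toReal_nonneg (ne_top_of_le_ne_top htop hT)
  have h2 : luxNorm p (Q.indicator fun x => ‖f x‖ₑ * w x) ≤
      l * (2 * K * t ^ ((p x)⁻¹).toReal) := by
    refine le_trans (luxNorm_mono_ae (Filter.Eventually.of_forall fun y => ?_))
      ((luxNorm_const_mul_le hp.isQuasiExponent (c := (l : ℝ≥0∞)) ENNReal.coe_ne_top
        (Q.indicator fun x => ‖f x‖ₑ * w x / (l : ℝ≥0∞))).trans (by gcongr))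
    by_cases hy : y ∈ Q
    · simp [hy, ENNReal.mul_div_cancel hl0 ENNReal.coe_ne_top]
    · simp [hy]
  have h3 : luxNorm p (Q.indicator fun x => ‖f x‖ₑ * w x) ≠ ∞ :=
    ne_top_of_le_ne_top (by finiteness) h2
  refine (enorm_setAverage_le hQ f).trans ?_
  gcongr
  refine (setLIntegral_enorm_le hp hw hf hQ.measurableSet h3 hN).trans ?_
  calc _ ≤ 2 * (l * (2 * K * t ^ ((p x)⁻¹).toReal)) *
        luxNorm (dualExp p) (Q.indicator fun x => (w x)⁻¹) := by gcongr
    _ = _ := by ring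

theorem famBounded_of_bilinearAp {n : ℕ} {p₁ p₂ w₁ w₂ : Rn n → ℝ≥0∞}
    (hp₁ : IsExponent p₁) (hp₂ : IsExponent p₂) (hw₁ : IsWeight w₁) (hw₂ : IsWeight w₂)
    (hlh₁ : LogHolder p₁) (hlh₂ : LogHolder p₂) (h : BilinearAp p₁ p₂ w₁ w₂) :
    FamBounded p₁ p₂ w₁ w₂ := by
  obtain ⟨K, hK⟩ := h.exists_bound hp₁ hp₂ hw₁ hw₂
  have hp := hp₁.sumExp_isQuasiExponent hp₂
  set H : ℝ≥0 := (∫⁻ z : Rn n, decay z).toNNReal with hHdef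
  have hH : (H : ℝ≥0∞) = ∫⁻ z : Rn n, decay z := ENNReal.coe_toNNReal (lintegral_decay_lt_top n).ne
  obtain ⟨K₁, hK₁0, hK₁⟩ := hlh₁.rpow_le_mul_rpow hp₁ (T := 1 + H) le_self_add
  obtain ⟨K₂, hK₂0, hK₂⟩ := hlh₂.rpow_le_mul_rpow hp₂ (T := 1 + H) le_self_add
  simp only [ENNReal.coe_add, ENNReal.coe_one, hH] at hK₁ hK₂
  -- Total energy 2 + 2H, plus 1 for the supremum part.
  set E : ℝ≥0 := 3 + 2 * H with hE
  have hE1 : 1 ≤ E := le_add_right (by norm_num)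
  have hE0 : (E : ℝ≥0∞) ≠ 0 := by
    simpa using (zero_lt_one.trans_le hE1).ne'
  -- 32 = 4 · 4 · 2: a 4 from each average and a 2 from normalizing w by 2W. E² cancels ε², and K +
  -- 1 keeps C positive when K = 0.
  set C : ℝ≥0 := 32 * K₁ * K₂ * (K + 1) * E ^ 2 with hC
  have hC0 : 0 < C := by positivity
  refine ⟨C, fun f₁ f₂ hf₁ hf₂ 𝒬 h𝒬 hd => ⟨fun Q hQ => ?_, ?_⟩⟩
  · obtain ⟨_, hA⟩ := avgBounded_of_bilinearAp hp₁ hp₂ hw₁ hw₂ h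
    obtain ⟨h1, h2, -⟩ := hA f₁ f₂ hf₁ hf₂ Q (h𝒬 Q hQ)
    exact ⟨h1, h2⟩
  refine le_mul_luxNorm_mul_luxNorm (by simpa using hC0.ne') ENNReal.coe_ne_top
    (hf₂.weightedNorm_lt_top hp₂.isQuasiExponent).ne ?_
    (hf₁.weightedNorm_lt_top hp₁.isQuasiExponent).ne
  intro l m hl hm hmod₁ hmod₂
  rw [← ENNReal.coe_mul, ← ENNReal.coe_mul]
  refine luxNorm_le (by positivity) ?_
  set u₁ : Rn n → ℝ≥0∞ := fun x => ‖f₁ x‖ₑ * w₁ x / (l : ℝ≥0∞)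
  set u₂ : Rn n → ℝ≥0∞ := fun x => ‖f₂ x‖ₑ * w₂ x / (m : ℝ≥0∞)
  set τ : Set (Rn n) → ℝ≥0∞ := fun Q => cubeEnergy p₁ u₁ Q + cubeEnergy p₂ u₂ Q with hτ
  set W : Set (Rn n) → ℝ≥0∞ := fun Q =>
    luxNorm (sumExp p₁ p₂) (Q.indicator fun x => w₁ x * w₂ x) with hW
  have hτt : ∀ Q, τ Q ≠ ∞ := fun Q => by
    refine ne_top_of_le_ne_top ?_ (add_le_add (cubeEnergy_le hmod₁ Q) (cubeEnergy_le hmod₂ Q))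
    rw [← hH]
    finiteness
  -- The radius 2W lies strictly above the norm W, so attainment of the infimum is not needed.
  have hv : ∀ Q ∈ 𝒬, modular (sumExp p₁ p₂)
      (fun x => Q.indicator (fun x => w₁ x * w₂ x) x / (2 * W Q)) ≤ 1 := fun Q hQ => by
    obtain ⟨h0, h0', -⟩ := hK Q (h𝒬 Q hQ)
    have h2W : 2 * W Q ≠ ∞ := ENNReal.mul_ne_top ENNReal.ofNat_ne_top h0'
    have := modular_div_le_one_of_luxNorm_lt (p := sumExp p₁ p₂)
      (g := Q.indicator (fun x => w₁ x * w₂ x)) (l := (2 * W Q).toNNReal) (by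
        rw [ENNReal.coe_toNNReal h2W, two_mul]
        exact ENNReal.lt_add_right h0' h0)
    rwa [ENNReal.coe_toNNReal h2W] at this
  have hsum : ∑' Q : 𝒬, τ Q ≤ 2 + 2 * H := by
    simp only [hτ]
    rw [ENNReal.tsum_add]
    refine (add_le_add (tsum_cubeEnergy_le hmod₁ h𝒬 hd)
      (tsum_cubeEnergy_le hmod₂ h𝒬 hd)).trans_eq ?_
    rw [← hH]
    ring
  refine (modular_le_of_forall_cube hp h𝒬 hd hv (τ := τ) (fun Q _ => hτt Q)
    (ε := (E : ℝ≥0∞)⁻¹) (ENNReal.inv_le_one.2 (by exact_mod_cast hE1)) ?_ ?_).trans ?_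
  · intro Q hQ x hx
    obtain ⟨h0, h0', h1, h2, hle⟩ := hK Q (h𝒬 Q hQ)
    have a1 := enorm_setAverage_le_cubeEnergy hp₁ hw₁ hK₁0 hK₁ hf₁.1 hl hmod₁ (h𝒬 Q hQ) h1 hx
    have a2 := enorm_setAverage_le_cubeEnergy hp₂ hw₂ hK₂0 hK₂ hf₂.1 hm hmod₂ (h𝒬 Q hQ) h2 hx
    set N₁ := luxNorm (dualExp p₁) (Q.indicator fun x => (w₁ x)⁻¹)
    set N₂ := luxNorm (dualExp p₂) (Q.indicator fun x => (w₂ x)⁻¹)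
    have hN : ((volume Q) ^ 2)⁻¹ * N₁ * N₂ ≤ K * (W Q)⁻¹ := by
      rw [← div_eq_mul_inv, ENNReal.le_div_iff_mul_le (Or.inl h0) (Or.inl h0')]
      exact le_trans (le_of_eq (by ring)) hle
    -- Both energies are at most τ, and the exponents 1/p₁(x) and 1/p₂(x) add up to 1/p(x). This
    -- needs both powers at the same point x, which the energy bounds allow.
    have hpow : cubeEnergy p₁ u₁ Q ^ ((p₁ x)⁻¹).toReal * cubeEnergy p₂ u₂ Q ^ ((p₂ x)⁻¹).toReal ≤
        τ Q ^ ((sumExp p₁ p₂ x)⁻¹).toReal := by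
      rw [sumExp, inv_inv, ENNReal.toReal_add (hp₁.inv_ne_top x) (hp₂.inv_ne_top x),
        ENNReal.rpow_add_of_nonneg _ _ ENNReal.toReal_nonneg ENNReal.toReal_nonneg]
      exact mul_le_mul' (ENNReal.rpow_le_rpow le_self_add ENNReal.toReal_nonneg)
        (ENNReal.rpow_le_rpow le_add_self ENNReal.toReal_nonneg)
    rw [famOp_apply hd hQ hx, enorm_mul, Set.indicator_of_mem hx]
    refine ENNReal.div_le_of_le_mul ?_
    set s := τ Q ^ ((sumExp p₁ p₂ x)⁻¹).toReal
    calc ‖⨍ y in Q, f₁ y‖ₑ * ‖⨍ y in Q, f₂ y‖ₑ * (w₁ x * w₂ x)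
        ≤ (volume Q)⁻¹ * (4 * K₁ * l * cubeEnergy p₁ u₁ Q ^ ((p₁ x)⁻¹).toReal * N₁) *
          ((volume Q)⁻¹ * (4 * K₂ * m * cubeEnergy p₂ u₂ Q ^ ((p₂ x)⁻¹).toReal * N₂)) *
          (w₁ x * w₂ x) := by gcongr
      _ = 16 * K₁ * K₂ * l * m * (cubeEnergy p₁ u₁ Q ^ ((p₁ x)⁻¹).toReal *
          cubeEnergy p₂ u₂ Q ^ ((p₂ x)⁻¹).toReal) * (((volume Q) ^ 2)⁻¹ * N₁ * N₂) *
          (w₁ x * w₂ x) := by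
          rw [ENNReal.inv_pow]
          ring
      _ ≤ 16 * K₁ * K₂ * l * m * s * ((K + 1) * (W Q)⁻¹) * (w₁ x * w₂ x) := by
          have hN' := hN.trans (mul_le_mul_left (le_self_add (b := 1)) (W Q)⁻¹)
          gcongr
      _ = (E : ℝ≥0∞)⁻¹ ^ 2 * s * (w₁ x * w₂ x / (2 * W Q)) * ((C * l * m : ℝ≥0) : ℝ≥0∞) := by
          have e1 : (E : ℝ≥0∞)⁻¹ ^ 2 * (E : ℝ≥0∞) ^ 2 = 1 := by
            rw [← mul_pow, ENNReal.inv_mul_cancel hE0 ENNReal.coe_ne_top, one_pow]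
          have e2 : (2 : ℝ≥0∞)⁻¹ * 32 = 16 := by
            rw [show (32 : ℝ≥0∞) = 2 * 16 by norm_num, ← mul_assoc,
              ENNReal.inv_mul_cancel two_ne_zero ENNReal.ofNat_ne_top, one_mul]
          rw [div_eq_mul_inv, ENNReal.mul_inv (by simp) (by simp), hC]
          push_cast
          calc _ = ((E : ℝ≥0∞)⁻¹ ^ 2 * (E : ℝ≥0∞) ^ 2) * ((2 : ℝ≥0∞)⁻¹ * 32) *
                (K₁ * K₂ * l * m * s * ((K + 1) * (W Q)⁻¹) * (w₁ x * w₂ x)) := by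
                rw [e1, e2]
                ring
            _ = _ := by ring
  · intro x hx
    simp [famOp_apply_of_notMem hx]
  · calc (E : ℝ≥0∞)⁻¹ * ∑' Q : 𝒬, τ Q + (E : ℝ≥0∞)⁻¹
        ≤ (E : ℝ≥0∞)⁻¹ * (2 + 2 * H) + (E : ℝ≥0∞)⁻¹ := by gcongr
      _ = (E : ℝ≥0∞)⁻¹ * E := by
          rw [hE]
          push_cast
          ring
      _ = 1 := ENNReal.inv_mul_cancel hE0 ENNReal.coe_ne_top

end VarLp
end

theorem theorem5p1 (n : ℕ) (hn : 1 ≤ n)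
    (p₁ p₂ : VarLp.Rn n → ENNReal) (hp₁ : VarLp.IsExponent p₁) (hp₂ : VarLp.IsExponent p₂)
    (w₁ w₂ : VarLp.Rn n → ENNReal) (hw₁ : VarLp.IsWeight w₁) (hw₂ : VarLp.IsWeight w₂) :
    (VarLp.BilinearAp p₁ p₂ w₁ w₂ ↔ VarLp.AvgBounded p₁ p₂ w₁ w₂) ∧
    (VarLp.LogHolder p₁ → VarLp.LogHolder p₂ →
      (VarLp.BilinearAp p₁ p₂ w₁ w₂ ↔ VarLp.FamBounded p₁ p₂ w₁ w₂)) :=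
  ⟨⟨VarLp.avgBounded_of_bilinearAp hp₁ hp₂ hw₁ hw₂, VarLp.bilinearAp_of_avgBounded hp₁ hp₂ hw₁ hw₂⟩,
    fun h₁ h₂ => ⟨VarLp.famBounded_of_bilinearAp hp₁ hp₂ hw₁ hw₂ h₁ h₂, fun h =>
      VarLp.bilinearAp_of_avgBounded hp₁ hp₂ hw₁ hw₂ (VarLp.avgBounded_of_famBounded h)⟩⟩
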